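/- Let $\Bbbk$ be a field and let $\mathcal{C}$ be a $\Bbbk$-linear abelian category in which every object has finite length. Let $(\Lambda,\leq)$ be a poset in which every set $\{\mu \mid \mu\leq\lambda\}$ is finite, and let $L_\lambda$ ($\lambda\in\Lambda$) be representatives of the isomorphism classes of simple objects of $\mathcal{C}$. For an order ideal $\Gamma\subseteq\Lambda$ let $\mathcal{C}_\Gamma$ be the Serre subcategory generated by the $L_\lambda$ with $\lambda\in\Gamma$, and write $\mathcal{C}_{\leq\lambda}=\mathcal{C}_{\{\mu\leq\lambda\}}$. Suppose that $\mathcal{C}$ is a highest weight category with weight poset $\Lambda$, that is, for all $\lambda,\mu\in\Lambda$: $L_\lambda$ has a projective cover $\Delta_\lambda\to L_\lambda$ and an injective hull $L_\lambda\to\nabla_\lambda$ in $\mathcal{C}_{\leq\lambda}$; $\mathrm{Hom}_{\mathcal{C}}(\Delta_\lambda,\nabla_\lambda)\cong\Bbbk$; and $\mathrm{Ext}^1_{\mathcal{C}}(\Delta_\lambda,\nabla_\mu)=\mathrm{Ext}^2_{\mathcal{C}}(\Delta_\lambda,\nabla_\mu)=0$. A tilting object is an object that has a finite filtration with all subquotients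 of the form $\Delta_\nu$ and also one with all subquotients of the form $\nabla_\nu$; $\mathrm{Tilt}(\mathcal{C})$ is the full subcategory of tilting objects. For $\mu\in\Lambda$ let $T_\mu$ be the indecomposable tilting object (unique up to isomorphism) that belongs to $\mathcal{C}_{\leq\mu}$ and has composition multiplicity $[T_\mu:L_\mu]=1$. The minimal tilting complex $C_{\min}(M)$ of an object $M$ is the bounded cochain complex in $\mathrm{Tilt}(\mathcal{C})$ (unique up to isomorphism) that is isomorphic in the derived category of $\mathcal{C}$ to $M$ placed in degree $0$ and all of whose differentials $d$ lie in the radical of $\mathrm{Tilt}(\mathcal{C})$, i.e. $b\circ d\circ a$ lies in the Jacobson radical of $\mathrm{End}(Z)$ for all tilting objects $Z$ and all morphisms $a$ from $Z$ to the source of $d$ and $b$ from the target of $d$ to $Z$. Write $[M:N]_\oplus$ for the number of summands isomorphic to $N$ in a decomposition of $M$ into finitely many indecomposable objects. For a finite order ideal $\Gamma\subseteq\Lambda$ let $T_\Gamma=\bigoplus_{\nu\in\Gamma}T_\nu\in\mathcal{C}_\Gamma$, let $\mathcal{C}_\Gamma'$ (the Ringel dual of $\mathcal{C}_\Gamma$)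 be the category of finite-dimensional left modules over $\mathrm{End}_{\mathcal{C}_\Gamma}(T_\Gamma)^{\mathrm{op}}$, and for $\nu\in\Gamma$ put $\Delta'_\nu=\mathrm{Hom}_{\mathcal{C}_\Gamma}(T_\Gamma,\nabla_\nu)$, $\nabla'_\nu=\mathrm{Hom}_{\mathcal{C}_\Gamma}(\Delta_\nu,T_\Gamma)^*$ (the $\Bbbk$-dual) and $L'_\nu=\mathrm{head}\,\Delta'_\nu$. Let $\lambda\in\Lambda$ and write $C_{\min}(\Delta_\lambda)=(T_\bullet,d_\bullet)$. Then for all $i\in\mathbb{Z}$ and $\mu\in\Lambda$ and for every finite order ideal $\Gamma\subseteq\Lambda$ with $\lambda\in\Gamma$, \[ [T_i:T_\mu]_\oplus=\begin{cases}\dim_\Bbbk\mathrm{Ext}^i_{\mathcal{C}_\Gamma'}(L'_\mu,\nabla'_\lambda)&\text{if } i\geq 0\text{ and }\mu\leq\lambda,\\ 0&\text{otherwise.}\end{cases} \] In particular these Ext-spaces are finite-dimensional. -/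

import Mathlib

open CategoryTheory CategoryTheory.Limits

universe u v w

noncomputable section

namespace HighestWeight

/-! ### Generalities on (additive, abelian) categories -/

section General

variable {D : Type u} [Category.{v} D]

/-- `p : P ⟶ X` is a projective cover: `P` is projective and `p` is an essential epimorphism. -/
structure IsProjectiveCover {P X : D} (p : P ⟶ X) : Prop where
  projective : Projective P
  epi : Epi p
  essential : ∀ ⦃Z : D⦄ (g : Z ⟶ P), Epi (g ≫ p) → Epi g

/-- `j : X ⟶ I` is an injective hull: `I` is injective and `j` is an essential monomorphism. -/
structure IsInjectiveHull {X I : D} (j : X ⟶ I) : Prop where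
  injective : Injective I
  mono : Mono j
  essential : ∀ ⦃Z : D⦄ (g : I ⟶ Z), Mono (j ≫ g) → Mono g

/-- The radical of a preadditive category: `f` belongs to `rad(X, Y)` if `b ∘ f ∘ a` belongs to
the Jacobson radical of `End Z` for all objects `Z` and all `a : Z ⟶ X`, `b : Y ⟶ Z`. -/
def InRadical [Preadditive D] {X Y : D} (f : X ⟶ Y) : Prop :=
  ∀ (Z : D) (a : Z ⟶ X) (b : Y ⟶ Z), (a ≫ f ≫ b : End Z) ∈ Ring.jacobson (End Z)

/-- A cochain complex is minimal if all its differentials belong to the radical. -/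
def IsMinimalComplex [Preadditive D] (K : CochainComplex D ℤ) : Prop :=
  ∀ i : ℤ, InRadical (K.d i (i + 1))

/-- A complex is bounded if all but finitely many of its terms are zero. -/
def IsBoundedComplex [Preadditive D] (K : CochainComplex D ℤ) : Prop :=
  ∃ a b : ℤ, ∀ i : ℤ, i < a ∨ b < i → IsZero (K.X i)

variable [Abelian D]

/-- The group `Ext^n(X, Y) = Hom(X, Y[n])` in the derived category of an abelian category. -/
abbrev ExtGroup (X Y : D) (n : ℕ) : Type (max u v) :=
  @Abelian.Ext.{max u v} D _ _ (HasExt.standard D) X Y n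

/-- `HasFiltration S M [a₁, …, aᵣ]`: there is a filtration `0 = M₀ ⊆ M₁ ⊆ ⋯ ⊆ Mᵣ = M` with
subquotients (listed from the top) `S a₁, …, S aᵣ`, up to isomorphism. -/
inductive HasFiltration {ι : Type w} (S : ι → D) : D → List ι → Prop
  | zero {M : D} (hM : IsZero M) : HasFiltration S M []
  | step {E : ShortComplex D} (hE : E.ShortExact) {l : List ι} (h : HasFiltration S E.X₁ l)
      {a : ι} (e : E.X₃ ≅ S a) : HasFiltration S E.X₂ (a :: l)

instance hasFiniteBiproducts_of_abelian : HasFiniteBiproducts D :=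
  Abelian.hasFiniteBiproducts

/-- `[M : N]_⊕ = n`: the object `M` has a decomposition as a finite direct sum of indecomposable
objects, and in every such decomposition exactly `n` of the summands are isomorphic to `N`. -/
def HasSummandMultiplicity (M N : D) (n : ℕ) : Prop :=
  (∃ (r : ℕ) (X : Fin r → D), (∀ j, Indecomposable (X j)) ∧ Nonempty (M ≅ ⨁ X)) ∧
  ∀ (r : ℕ) (X : Fin r → D), (∀ j, Indecomposable (X j)) → Nonempty (M ≅ ⨁ X) →
    Nat.card {j : Fin r // Nonempty (X j ≅ N)} = n

/-- A Serre class is closed under finite products. -/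
instance isClosedUnderFiniteProducts_of_isSerreClass (P : ObjectProperty D) [P.IsSerreClass] :
    P.IsClosedUnderFiniteProducts :=
  have : P.IsClosedUnderBinaryProducts := .mk' (by
    rintro X ⟨F, hF⟩
    have e : F ≅ pair (F.obj ⟨.left⟩) (F.obj ⟨.right⟩) := diagramIsoPair F
    exact P.prop_of_iso ((biprod.isoProd _ _) ≪≫ (HasLimit.isoOfNatIso e).symm)
      (P.prop_biprod (hF _) (hF _)))
  have : P.IsClosedUnderLimitsOfShape (Discrete.{0} PEmpty) := .mk' (by
    rintro X ⟨F, hF⟩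
    refine P.prop_of_isZero ?_
    have : IsTerminal (limit F) := by
      have e : F ≅ Functor.empty D := Functor.emptyExt _ _
      exact IsTerminal.ofIso terminalIsTerminal (HasLimit.isoOfNatIso e).symm
    exact (isZero_zero D).of_iso (this.uniqueUpToIso HasZeroObject.zeroIsTerminal))
  .mk'

/-- The Serre subcategory generated by the objects `S a`, for `a ∈ Γ`. -/
def serreGenerated {ι : Type w} (S : ι → D) (Γ : Set ι) : ObjectProperty D :=
  fun X ↦ ∀ P : ObjectProperty D, P.IsSerreClass → (∀ a ∈ Γ, P (S a)) → P X

instance {ι : Type w} (S : ι → D) (Γ : Set ι) : (serreGenerated S Γ).IsSerreClass where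
  exists_zero := ⟨(HasZeroObject.zero' D).zero, isZero_zero D, fun P _ _ ↦ P.prop_zero⟩
  prop_of_mono f _ hY P hP h := P.prop_of_mono f (hY P hP h)
  prop_of_epi f _ hX P hP h := P.prop_of_epi f (hX P hP h)
  prop_X₂_of_shortExact hS h₁ h₃ P hP h :=
    P.prop_X₂_of_shortExact hS (h₁ P hP h) (h₃ P hP h)

lemma serreGenerated_of_mem {ι : Type w} (S : ι → D) {Γ : Set ι} {a : ι} (ha : a ∈ Γ) :
    serreGenerated S Γ (S a) :=
  fun _ _ h ↦ h a ha

lemma serreGenerated_mono {ι : Type w} (S : ι → D) {Γ Γ' : Set ι} (h : Γ ⊆ Γ') :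
    serreGenerated S Γ ≤ serreGenerated S Γ' :=
  fun _ hX P hP h' ↦ hX P hP fun a ha ↦ h' a (h ha)

end General

/-! ### Highest weight categories -/

/-- The structure of a highest weight category with weight poset `Λ` on the `k`-linear abelian
category `C`. -/
structure HighestWeightCategory (k : Type v) [Field k] (Λ : Type w) [PartialOrder Λ]
    (C : Type u) [Category.{v} C] [Abelian C] [Linear k C] where
  /-- the poset is lower finite -/
  lowerFinite : ∀ a : Λ, (Set.Iic a).Finite
  /-- the simple objects -/
  L : Λ → C
  simple : ∀ a, Simple (L a)
  eq_of_iso : ∀ a b, Nonempty (L a ≅ L b) → a = b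
  exists_iso : ∀ X : C, Simple X → ∃ a, Nonempty (X ≅ L a)
  /-- every object has a composition series -/
  finiteLength : ∀ X : C, ∃ l : List Λ, HasFiltration L X l
  /-- the standard objects -/
  Δ : Λ → C
  Δ_mem : ∀ a, serreGenerated L (Set.Iic a) (Δ a)
  π : ∀ a, Δ a ⟶ L a
  /-- `Δ a ⟶ L a` is a projective cover in `C_{≤ a}` -/
  isProjectiveCover : ∀ a, IsProjectiveCover
    ((serreGenerated L (Set.Iic a)).homMk (π a) :
      (⟨Δ a, Δ_mem a⟩ : (serreGenerated L (Set.Iic a)).FullSubcategory) ⟶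
        ⟨L a, serreGenerated_of_mem L (Set.self_mem_Iic)⟩)
  /-- the costandard objects -/
  nabla : Λ → C
  nabla_mem : ∀ a, serreGenerated L (Set.Iic a) (nabla a)
  incl : ∀ a, L a ⟶ nabla a
  /-- `L a ⟶ ∇ a` is an injective hull in `C_{≤ a}` -/
  isInjectiveHull : ∀ a, IsInjectiveHull
    ((serreGenerated L (Set.Iic a)).homMk (incl a) :
      (⟨L a, serreGenerated_of_mem L (Set.self_mem_Iic)⟩ :
        (serreGenerated L (Set.Iic a)).FullSubcategory) ⟶ ⟨nabla a, nabla_mem a⟩)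
  hom_Δ_nabla : ∀ a, Nonempty ((Δ a ⟶ nabla a) ≃ₗ[k] k)
  ext_one : ∀ a b, Subsingleton (ExtGroup (Δ a) (nabla b) 1)
  ext_two : ∀ a b, Subsingleton (ExtGroup (Δ a) (nabla b) 2)

namespace HighestWeightCategory

variable {k : Type v} [Field k] {Λ : Type w} [PartialOrder Λ]
  {C : Type u} [Category.{v} C] [Abelian C] [Linear k C]
  (H : HighestWeightCategory k Λ C)

/-- All `Hom`-spaces in a highest weight category are finite-dimensional. -/
lemma finite_hom (H : HighestWeightCategory k Λ C) (X Y : C) : Module.Finite k (X ⟶ Y) := by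
  have hLL (a b : Λ) : IsNoetherian k (H.L a ⟶ H.L b) := by
    have := H.simple a
    have := H.simple b
    by_cases hab : a = b
    · subst hab
      let P := serreGenerated H.L (Set.Iic a)
      have := P.preservesEpimorphisms_ι_of_isNormalMonoCategory
      have := P.preservesMonomorphisms_ι_of_isNormalEpiCategory
      have hπ : Epi (H.π a) := by
        have := (H.isProjectiveCover a).epi
        exact inferInstanceAs (Epi (P.ι.map (P.homMk (H.π a) :
          (⟨H.Δ a, H.Δ_mem a⟩ : P.FullSubcategory) ⟶
            ⟨H.L a, serreGenerated_of_mem H.L Set.self_mem_Iic⟩)))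
      have hι : Mono (H.incl a) := by
        have := (H.isInjectiveHull a).mono
        exact inferInstanceAs (Mono (P.ι.map (P.homMk (H.incl a) :
          (⟨H.L a, serreGenerated_of_mem H.L Set.self_mem_Iic⟩ : P.FullSubcategory) ⟶
            ⟨H.nabla a, H.nabla_mem a⟩)))
      obtain ⟨e⟩ := H.hom_Δ_nabla a
      have : IsNoetherian k (H.Δ a ⟶ H.nabla a) := isNoetherian_of_linearEquiv e.symm
      refine isNoetherian_of_injective
        ((Linear.rightComp k (H.Δ a) (H.incl a)).comp (Linear.leftComp k (H.L a) (H.π a))) ?_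
      intro f g hfg
      simpa [cancel_epi, cancel_mono] using hfg
    · have : Subsingleton (H.L a ⟶ H.L b) := by
        refine ⟨fun f g ↦ ?_⟩
        have h0 (f : H.L a ⟶ H.L b) : f = 0 := by
          by_contra hf
          have := isIso_of_hom_simple hf
          exact hab (H.eq_of_iso a b ⟨asIso f⟩)
        rw [h0 f, h0 g]
      infer_instance
  have hLY (a : Λ) (Y : C) : IsNoetherian k (H.L a ⟶ Y) := by
    obtain ⟨l, hl⟩ := H.finiteLength Y
    induction hl with
    | zero hM =>
      have : Subsingleton (H.L a ⟶ _) := ⟨fun f g ↦ hM.eq_of_tgt f g⟩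
      infer_instance
    | @step E hE l h b e ih =>
      have := hLL a b
      have : IsNoetherian k (H.L a ⟶ E.X₃) := by
        refine isNoetherian_of_injective (Linear.rightComp k (H.L a) e.hom) ?_
        intro f g hfg
        simpa [cancel_mono] using hfg
      refine isNoetherian_of_range_eq_ker (Linear.rightComp k (H.L a) E.f)
        (Linear.rightComp k (H.L a) E.g) ?_
      have := hE.mono_f
      ext f
      constructor
      · rintro ⟨g, rfl⟩
        simp
      · intro hf
        exact ⟨hE.exact.lift f (by simpa using hf), by simp⟩
  have hXY : IsNoetherian k (X ⟶ Y) := by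
    obtain ⟨l, hl⟩ := H.finiteLength X
    induction hl with
    | zero hM =>
      have : Subsingleton (_ ⟶ Y) := ⟨fun f g ↦ hM.eq_of_src f g⟩
      infer_instance
    | @step E hE l h b e ih =>
      have := hLY b Y
      have : IsNoetherian k (E.X₃ ⟶ Y) := by
        refine isNoetherian_of_injective (Linear.leftComp k Y e.inv) ?_
        intro f g hfg
        simpa [cancel_epi] using hfg
      refine isNoetherian_of_range_eq_ker (Linear.leftComp k Y E.g)
        (Linear.leftComp k Y E.f) ?_
      have := hE.epi_g
      ext f
      constructor
      · rintro ⟨g, rfl⟩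
        simp
      · intro hf
        exact ⟨hE.exact.desc f (by simpa using hf), by simp⟩
  infer_instance

/-- The tilting objects: those with both a `Δ`-filtration and a `∇`-filtration. -/
def isTilting : ObjectProperty C :=
  fun M ↦ (∃ l, HasFiltration H.Δ M l) ∧ (∃ l, HasFiltration H.nabla M l)

/-- The full subcategory `Tilt(C)` of tilting objects. -/
abbrev Tilt : Type u := H.isTilting.FullSubcategory

open scoped Classical in
/-- `M` is the indecomposable tilting object `T_a` of highest weight `a`: it is an indecomposable
tilting object that belongs to `C_{≤ a}` and satisfies `[M : L_a] = 1`. -/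
structure IsIndecomposableTilting (a : Λ) (M : C) : Prop where
  indecomposable : Indecomposable M
  tilting : H.isTilting M
  mem : serreGenerated H.L (Set.Iic a) M
  multiplicity : ∃ l, HasFiltration H.L M l ∧ l.count a = 1

/-- `K` is the minimal tilting complex `C_min(X)` of the complex `X`: it is a bounded
minimal complex in `Tilt(C)` that is isomorphic to `X` in the derived category of `C`. -/
structure IsMinimalTiltingComplex (X : CochainComplex C ℤ) (K : CochainComplex H.Tilt ℤ) :
    Prop where
  bounded : IsBoundedComplex K
  minimal : IsMinimalComplex K
  iso : letI := HasDerivedCategory.standard C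
    Nonempty (DerivedCategory.Q.obj
      ((H.isTilting.ι.mapHomologicalComplex (ComplexShape.up ℤ)).obj K) ≅
        DerivedCategory.Q.obj X)

end HighestWeightCategory

/-! ### Finite-dimensional modules over the endomorphism algebra of an object -/

section RingelDual

open ModuleCat

/-- The finite-dimensional left modules over a `k`-algebra `A`. -/
def finiteDimensional (k : Type v) [Field k] (A : Type v) [Ring A] [Algebra k A] :
    ObjectProperty (ModuleCat.{v} A) :=
  fun M ↦ Module.Finite k M

instance (k : Type v) [Field k] (A : Type v) [Ring A] [Algebra k A] :
    (finiteDimensional k A).IsSerreClass where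
  exists_zero := by
    have (M : ModuleCat.{v} A) (hM : Subsingleton M) : finiteDimensional k A M :=
      inferInstanceAs (Module.Finite k M)
    exact ⟨ModuleCat.of A PUnit, ModuleCat.isZero_of_subsingleton _,
      this _ (inferInstanceAs (Subsingleton PUnit))⟩
  prop_of_mono {X Y} f hf (hY : Module.Finite k Y) :=
    Module.Finite.of_injective (f.hom.restrictScalars k) ((ModuleCat.mono_iff_injective f).1 hf)
  prop_of_epi {X Y} f hf (hX : Module.Finite k X) :=
    Module.Finite.of_surjective (f.hom.restrictScalars k) ((ModuleCat.epi_iff_surjective f).1 hf)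
  prop_X₂_of_shortExact {S} hS (h₁ : Module.Finite k S.X₁) (h₃ : Module.Finite k S.X₃) := by
    have : IsNoetherian k S.X₂ := isNoetherian_of_range_eq_ker (S.f.hom.restrictScalars k)
      (S.g.hom.restrictScalars k) (by
        ext x
        have := hS.exact.moduleCat_range_eq_ker
        simpa using (SetLike.ext_iff.1 this x))
    exact inferInstanceAs (Module.Finite k S.X₂)

lemma finiteDimensional_of_surjective {k : Type v} [Field k] {A : Type v} [Ring A] [Algebra k A]
    {V : Type v} [AddCommGroup V] [Module k V] [Module.Finite k V] (M : ModuleCat.{v} A)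
    (e : V →+ M) (he : Function.Surjective e)
    (h : ∀ (c : k) (x : V), e (c • x) = algebraMap k A c • e x) : finiteDimensional k A M :=
  Module.Finite.of_surjective
    ({ e with map_smul' := fun c x ↦ (h c x).trans (algebraMap_smul A c (e x)) } : V →ₗ[k] M) he

variable {k : Type v} [Field k] {D : Type u} [Category.{v} D] [Preadditive D] [Linear k D]

variable (k) in
/-- The category of finite-dimensional left modules over the algebra `(End T)ᵐᵒᵖ`.
When `T` is the characteristic tilting object of a highest weight category
with finite weight poset, this is the Ringel dual. -/
abbrev RingelDual (T : D) : Type (v + 1) := (finiteDimensional k (End T)ᵐᵒᵖ).FullSubcategory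

variable (k) in
/-- The left `(End T)ᵐᵒᵖ`-module `Hom(T, X)`, with the action by precomposition. -/
def homFrom (T X : D) [hX : Module.Finite k (T ⟶ X)] : RingelDual k T where
  obj := ModuleCat.of (End T)ᵐᵒᵖ (T ⟶ X)
  property := finiteDimensional_of_surjective (V := T ⟶ X) _ (AddMonoidHom.id (T ⟶ X))
    (fun f ↦ ⟨f, rfl⟩) (fun c f ↦ by
      change c • f = (c • 𝟙 T) ≫ f
      simp)

/-- The left `(End T)ᵐᵒᵖ`-module structure on the dual of `Hom(X, T)`: it is dual to the
action of `End T` on `Hom(X, T)` by postcomposition. -/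
@[reducible]
def dualModule (T X : D) : Module (End T)ᵐᵒᵖ (Module.Dual k (X ⟶ T)) where
  smul a φ := φ.comp (Linear.rightComp k X (a.unop : T ⟶ T))
  one_smul φ := by
    ext f
    exact congrArg φ (Category.comp_id f)
  mul_smul a b φ := by
    ext f
    exact congrArg φ (Category.assoc f a.unop b.unop).symm
  smul_zero _ := rfl
  smul_add _ _ _ := rfl
  add_smul a b φ := by
    ext f
    exact (congrArg φ (Preadditive.comp_add _ _ _ f a.unop b.unop)).trans (φ.map_add _ _)
  zero_smul φ := by
    ext f
    exact (congrArg φ (comp_zero (f := f))).trans φ.map_zero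

variable (k) in
/-- The left `(End T)ᵐᵒᵖ`-module `Hom(X, T)^*`. -/
def dualHomTo (T X : D) [hX : Module.Finite k (X ⟶ T)] : RingelDual k T where
  obj := letI := dualModule (k := k) T X
    ModuleCat.of (End T)ᵐᵒᵖ (Module.Dual k (X ⟶ T))
  property := by
    let := dualModule (k := k) T X
    refine finiteDimensional_of_surjective (V := Module.Dual k (X ⟶ T)) _
      (AddMonoidHom.id (Module.Dual k (X ⟶ T))) (fun f ↦ ⟨f, rfl⟩) (fun c φ ↦ ?_)
    refine LinearMap.ext fun f ↦ ?_
    change c • φ f = φ (f ≫ (c • 𝟙 T))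
    simp

/-- The head of a finite-dimensional module: its quotient by the intersection of
its maximal submodules. -/
def head {T : D} (M : RingelDual k T) : RingelDual k T where
  obj := ModuleCat.of (End T)ᵐᵒᵖ (M.obj ⧸ Module.jacobson (End T)ᵐᵒᵖ M.obj)
  property := by
    have : Epi (ModuleCat.ofHom (Module.jacobson (End T)ᵐᵒᵖ M.obj).mkQ) :=
      (ModuleCat.epi_iff_surjective _).2 (Submodule.mkQ_surjective _)
    exact (finiteDimensional k (End T)ᵐᵒᵖ).prop_of_epi
      (ModuleCat.ofHom (Module.jacobson (End T)ᵐᵒᵖ M.obj).mkQ) M.property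

end RingelDual

/-! ### Truncation and the Ringel dual of a finite truncation -/

namespace HighestWeightCategory

variable {k : Type v} [Field k] {Λ : Type w} [PartialOrder Λ]
  {C : Type u} [Category.{v} C] [Abelian C] [Linear k C]
  (H : HighestWeightCategory k Λ C) (Γ : LowerSet Λ)

/-- The truncated category `C_Γ`, for an order ideal `Γ`. -/
abbrev Truncation : Type u := (serreGenerated H.L (Γ : Set Λ)).FullSubcategory

variable {Γ}

lemma mem_truncation {a : Λ} (ha : a ∈ Γ) {X : C} (hX : serreGenerated H.L (Set.Iic a) X) :
    serreGenerated H.L (Γ : Set Λ) X :=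
  serreGenerated_mono H.L (fun _ hb ↦ Γ.lower hb ha) X hX

instance finite_hom_truncation (X Y : H.Truncation Γ) : Module.Finite k (X ⟶ Y) := by
  have := H.finite_hom X.obj Y.obj
  exact Module.Finite.of_injective
    ({ toFun f := f.hom
       map_add' _ _ := rfl
       map_smul' _ _ := rfl } : (X ⟶ Y) →ₗ[k] (X.obj ⟶ Y.obj))
    fun f g h ↦ ObjectProperty.hom_ext _ h

/-- The standard object of highest weight `a ∈ Γ` in `C_Γ`. -/
def truncΔ (a : Γ) : H.Truncation Γ := ⟨H.Δ a, H.mem_truncation a.2 (H.Δ_mem a)⟩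

/-- The costandard object of highest weight `a ∈ Γ` in `C_Γ`. -/
def truncNabla (a : Γ) : H.Truncation Γ := ⟨H.nabla a, H.mem_truncation a.2 (H.nabla_mem a)⟩

variable {T : Λ → C} (hT : ∀ a, H.IsIndecomposableTilting a (T a))

variable (Γ) in
/-- The characteristic tilting object `⨁_{a ∈ Γ} T_a` of `C_Γ`. -/
def charTilting [Finite Γ] : H.Truncation Γ :=
  ⨁ fun a : Γ ↦ (⟨T a, H.mem_truncation a.2 (hT a).mem⟩ : H.Truncation Γ)

variable (Γ) in
/-- The Ringel dual `C_Γ'` of `C_Γ`: the finite-dimensional left modules over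
`(End T)ᵐᵒᵖ`, where `T` is the characteristic tilting object of `C_Γ`. -/
abbrev TruncRingelDual [Finite Γ] : Type (v + 1) := RingelDual k (H.charTilting Γ hT)

/-- The standard object `Δ'_a = Hom(T, ∇_a)` of `C_Γ'`. -/
def dualΔ [Finite Γ] (a : Γ) : H.TruncRingelDual Γ hT :=
  homFrom k (H.charTilting Γ hT) (H.truncNabla a)

/-- The costandard object `∇'_a = Hom(Δ_a, T)^*` of `C_Γ'`. -/
def dualNabla [Finite Γ] (a : Γ) : H.TruncRingelDual Γ hT :=
  dualHomTo k (H.charTilting Γ hT) (H.truncΔ a)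

/-- The simple object `L'_a = head Δ'_a` of `C_Γ'`. -/
def dualL [Finite Γ] (a : Γ) : H.TruncRingelDual Γ hT := head (H.dualΔ hT a)

end HighestWeightCategory

end HighestWeight

end

/-! Both sides equal the rank of the composition pairing Hom(Δ_μ, X) × Hom(X, ∇_μ) → Hom(Δ_μ, ∇_μ) ≅
k for X = T_i.

Multiplicities. There are maps Δ_μ → T_μ → ∇_μ with nonzero composite. The Ext-vanishing makes it
possible to extend any map Δ_μ → X along the first and to lift any map X → ∇_μ along the second, for
X tilting. By Fitting's lemma an endomorphism of T_μ that stays nonzero between Δ_μ and ∇_μ is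
invertible. So a nonzero value of the pairing splits T_μ off X. The rank is additive, 1 on T_μ and 0
on every other indecomposable tilting object (`IsIndecomposableTilting.hasSummandMultiplicity`). By
the same argument radical morphisms pair to zero (`IsIndecomposableTilting.comp_radical_comp`).

Extensions. Minimality forces the complex to vanish in negative degrees (`isZero_X_of_neg`) and to
have only weights ≤ λ (`TiltingCoresolution.factorsIn`). Hence it is a coresolution of Δ_λ inside
C_Γ, and its cocycles have Δ-filtrations. The functor F = Hom(-, T_Γ)^* is therefore exact on it. It
sends Δ_λ to ∇'_λ and tilting objects to injectives (`injective_dualHomTo`), which gives an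
injective resolution of ∇'_λ. The radical of Δ'_μ is the kernel of the pairing on Hom(T_Γ, ∇_μ)
(`headMk_eq_zero_iff`), so Hom(L'_μ, F X) is dual to Hom(X, ∇_μ) modulo the kernel of the pairing
(`nonempty_hom_head_linearEquiv`). Since the differentials pair to zero, they induce zero on
Hom(L'_μ, -). Thus Ext^i(L'_μ, ∇'_λ) ≅ Hom(L'_μ, F T_i), whose dimension is the rank. -/

noncomputable section
namespace HighestWeight

/-! ### Vanishing of Ext along short exact sequences, retracts and filtrations -/

section Ext

open Abelian

variable {D : Type u} [Category.{v} D] [Abelian D] {S : ShortComplex D}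

lemma ext_X₂_left (hS : S.ShortExact) {Y : D} {n : ℕ} (h₁ : Subsingleton (ExtGroup S.X₁ Y n))
    (h₃ : Subsingleton (ExtGroup S.X₃ Y n)) : Subsingleton (ExtGroup S.X₂ Y n) := by
  let := HasExt.standard D
  refine subsingleton_of_forall_eq 0 fun x ↦ ?_
  obtain ⟨y, rfl⟩ := Ext.contravariant_sequence_exact₂ hS Y x (Subsingleton.elim _ _)
  rw [Subsingleton.elim y 0, Ext.comp_zero]

lemma ext_X₂_right (hS : S.ShortExact) {X : D} {n : ℕ} (h₁ : Subsingleton (ExtGroup X S.X₁ n))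
    (h₃ : Subsingleton (ExtGroup X S.X₃ n)) : Subsingleton (ExtGroup X S.X₂ n) := by
  let := HasExt.standard D
  refine subsingleton_of_forall_eq 0 fun x ↦ ?_
  obtain ⟨y, rfl⟩ := Ext.covariant_sequence_exact₂ X hS x (Subsingleton.elim _ _)
  rw [Subsingleton.elim y 0, Ext.zero_comp]

lemma ext_X₁_left (hS : S.ShortExact) {Y : D} {n : ℕ} (h₂ : Subsingleton (ExtGroup S.X₂ Y n))
    (h₃ : Subsingleton (ExtGroup S.X₃ Y (n + 1))) : Subsingleton (ExtGroup S.X₁ Y n) := by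
  let := HasExt.standard D
  refine subsingleton_of_forall_eq 0 fun x ↦ ?_
  obtain ⟨y, rfl⟩ := Ext.contravariant_sequence_exact₁ hS Y x (add_comm 1 n)
    (Subsingleton.elim _ _)
  rw [Subsingleton.elim y 0, Ext.comp_zero]

/-- A class that dies on `S.X₂` comes from some `f : S.X₁ ⟶ Y` by the connecting map, which kills
every `f` that extends to `S.X₂`. -/
lemma ext_X₃_left (hS : S.ShortExact) {Y : D} (h₂ : Subsingleton (ExtGroup S.X₂ Y 1))
    (h₁ : ∀ f : S.X₁ ⟶ Y, ∃ g : S.X₂ ⟶ Y, S.f ≫ g = f) :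
    Subsingleton (ExtGroup S.X₃ Y 1) := by
  let := HasExt.standard D
  refine subsingleton_of_forall_eq 0 fun x ↦ ?_
  obtain ⟨y, rfl⟩ := Ext.contravariant_sequence_exact₃ hS Y x (Subsingleton.elim _ _)
    (add_zero 1)
  obtain ⟨f, rfl⟩ := Ext.mk₀_bijective _ _ |>.surjective y
  obtain ⟨g, rfl⟩ := h₁ f
  rw [← Ext.mk₀_comp_mk₀, hS.extClass_comp_assoc]

lemma ext_X₁_right (hS : S.ShortExact) {X : D} (h₂ : Subsingleton (ExtGroup X S.X₂ 1))
    (h₃ : ∀ f : X ⟶ S.X₃, ∃ g : X ⟶ S.X₂, g ≫ S.g = f) :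
    Subsingleton (ExtGroup X S.X₁ 1) := by
  let := HasExt.standard D
  refine subsingleton_of_forall_eq 0 fun x ↦ ?_
  obtain ⟨y, rfl⟩ := Ext.covariant_sequence_exact₁ X hS x (Subsingleton.elim _ _)
    (zero_add 1)
  obtain ⟨f, rfl⟩ := Ext.mk₀_bijective _ _ |>.surjective y
  obtain ⟨g, rfl⟩ := h₃ f
  rw [← Ext.mk₀_comp_mk₀, Ext.comp_assoc _ _ _ (zero_add 0) (zero_add 1) (by simp),
    hS.comp_extClass, Ext.comp_zero]

lemma exists_extension (hS : S.ShortExact) {Y : D} (h : Subsingleton (ExtGroup S.X₃ Y 1))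
    (f : S.X₁ ⟶ Y) : ∃ g : S.X₂ ⟶ Y, S.f ≫ g = f := by
  let := HasExt.standard D
  obtain ⟨y, hy⟩ := Ext.contravariant_sequence_exact₁ hS Y (Ext.mk₀ f) (add_zero 1)
    (Subsingleton.elim _ _)
  obtain ⟨g, rfl⟩ := Ext.mk₀_bijective _ _ |>.surjective y
  exact ⟨g, (Ext.mk₀_bijective _ _).injective (by rw [← hy, Ext.mk₀_comp_mk₀])⟩

lemma exists_lift (hS : S.ShortExact) {X : D} (h : Subsingleton (ExtGroup X S.X₁ 1))
    (f : X ⟶ S.X₃) : ∃ g : X ⟶ S.X₂, g ≫ S.g = f := by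
  let := HasExt.standard D
  obtain ⟨y, hy⟩ := Ext.covariant_sequence_exact₃ X hS (Ext.mk₀ f) (zero_add 1)
    (Subsingleton.elim _ _)
  obtain ⟨g, rfl⟩ := Ext.mk₀_bijective _ _ |>.surjective y
  exact ⟨g, (Ext.mk₀_bijective _ _).injective (by rw [← hy, Ext.mk₀_comp_mk₀])⟩

/-- The partition of the identity exhibits `X` as a retract of the direct sum of the `Z j`. In this
form no biproduct has to be chosen; retracts (one index) and zero objects (no index) are special
cases. -/
lemma ext_of_sum_left {X Y : D} {n : ℕ} {ι : Type*} [Fintype ι] {Z : ι → D} (a : ∀ j, X ⟶ Z j)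
    (b : ∀ j, Z j ⟶ X) (hab : ∑ j, a j ≫ b j = 𝟙 X)
    (h : ∀ j, Subsingleton (ExtGroup (Z j) Y n)) : Subsingleton (ExtGroup X Y n) := by
  let := HasExt.standard D
  refine subsingleton_of_forall_eq 0 fun x ↦ ?_
  rw [← Ext.mk₀_id_comp x, ← hab, Ext.mk₀_sum, Ext.sum_comp]
  refine Finset.sum_eq_zero fun j _ ↦ ?_
  rw [← Ext.mk₀_comp_mk₀, Ext.comp_assoc _ _ _ (zero_add 0) (zero_add n) (by simp),
    Subsingleton.elim (Ext.comp (Ext.mk₀ (b j)) x _) 0, Ext.comp_zero]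

lemma ext_of_sum_right {X Y : D} {n : ℕ} {ι : Type*} [Fintype ι] {Z : ι → D} (a : ∀ j, Y ⟶ Z j)
    (b : ∀ j, Z j ⟶ Y) (hab : ∑ j, a j ≫ b j = 𝟙 Y)
    (h : ∀ j, Subsingleton (ExtGroup X (Z j) n)) : Subsingleton (ExtGroup X Y n) := by
  let := HasExt.standard D
  refine subsingleton_of_forall_eq 0 fun x ↦ ?_
  rw [← Ext.comp_mk₀_id x, ← hab, Ext.mk₀_sum, Ext.comp_sum]
  refine Finset.sum_eq_zero fun j _ ↦ ?_
  rw [← Ext.mk₀_comp_mk₀, ← Ext.comp_assoc _ _ _ (add_zero n) (zero_add 0) (by simp),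
    Subsingleton.elim (Ext.comp x (Ext.mk₀ (a j)) _) 0, Ext.zero_comp]

lemma ext_of_retract_left {X Y Z : D} {n : ℕ} (a : X ⟶ Z) (b : Z ⟶ X) (hab : a ≫ b = 𝟙 X)
    (h : Subsingleton (ExtGroup Z Y n)) : Subsingleton (ExtGroup X Y n) :=
  ext_of_sum_left (ι := Unit) (fun _ ↦ a) (fun _ ↦ b) (by simpa) fun _ ↦ h

lemma ext_of_retract_right {X Y Z : D} {n : ℕ} (a : Y ⟶ Z) (b : Z ⟶ Y) (hab : a ≫ b = 𝟙 Y)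
    (h : Subsingleton (ExtGroup X Z n)) : Subsingleton (ExtGroup X Y n) :=
  ext_of_sum_right (ι := Unit) (fun _ ↦ a) (fun _ ↦ b) (by simpa) fun _ ↦ h

lemma ext_of_isZero_left {X Y : D} {n : ℕ} (h : IsZero X) : Subsingleton (ExtGroup X Y n) :=
  ext_of_sum_left (ι := Empty) (Z := Empty.elim) nofun nofun (h.eq_of_src _ _) nofun

lemma ext_of_isZero_right {X Y : D} {n : ℕ} (h : IsZero Y) : Subsingleton (ExtGroup X Y n) :=
  ext_of_sum_right (ι := Empty) (Z := Empty.elim) nofun nofun (h.eq_of_src _ _) nofun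

variable {ι : Type w} {F : ι → D}

lemma HasFiltration.ext_left {X Y : D} {n : ℕ} {l : List ι} (hX : HasFiltration F X l)
    (h : ∀ a ∈ l, Subsingleton (ExtGroup (F a) Y n)) : Subsingleton (ExtGroup X Y n) := by
  induction hX with
  | zero hM => exact ext_of_isZero_left hM
  | step hE _ e ih =>
    exact ext_X₂_left hE (ih fun a ha ↦ h a (List.mem_cons_of_mem _ ha))
      (ext_of_retract_left e.hom e.inv e.hom_inv_id (h _ List.mem_cons_self))

lemma HasFiltration.ext_right {X Y : D} {n : ℕ} {l : List ι} (hY : HasFiltration F Y l)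
    (h : ∀ a ∈ l, Subsingleton (ExtGroup X (F a) n)) : Subsingleton (ExtGroup X Y n) := by
  induction hY with
  | zero hM => exact ext_of_isZero_right hM
  | step hE _ e ih =>
    exact ext_X₂_right hE (ih fun a ha ↦ h a (List.mem_cons_of_mem _ ha))
      (ext_of_retract_right e.hom e.inv e.hom_inv_id (h _ List.mem_cons_self))

lemma HasFiltration.prop {X : D} {l : List ι} (hX : HasFiltration F X l) (P : ObjectProperty D)
    [P.IsSerreClass] (h : ∀ a ∈ l, P (F a)) : P X := by
  induction hX with
  | zero hM => exact P.prop_of_isZero hM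
  | step hE _ e ih =>
    exact P.prop_X₂_of_shortExact hE (ih fun a ha ↦ h a (List.mem_cons_of_mem _ ha))
      (P.prop_of_iso e.symm (h _ List.mem_cons_self))

end Ext

section ShortExact

variable {D : Type u} [Category.{v} D] [Abelian D]

lemma shortExact_kernel {X Y : D} (f : X ⟶ Y) [Epi f] :
    (ShortComplex.mk (kernel.ι f) f (kernel.condition f)).ShortExact where
  exact := ShortComplex.exact_of_f_is_kernel _ (kernelIsKernel f)

lemma shortExact_cokernel {X Y : D} (f : X ⟶ Y) [Mono f] :
    (ShortComplex.mk f (cokernel.π f) (cokernel.condition f)).ShortExact where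
  exact := ShortComplex.exact_of_g_is_cokernel _ (cokernelIsCokernel f)

end ShortExact

/-! ### Idempotents and splittings of indecomposable objects -/

section Indecomposable

/-- The biproduct over a disjoint union is the biproduct of the biproducts. -/
def biproductSumIso {D : Type u} [Category.{v} D] [Abelian D] {r s : ℕ} (Z : Fin r ⊕ Fin s → D) :
    ⨁ Z ≅ (⨁ fun j ↦ Z (.inl j)) ⊞ (⨁ fun j ↦ Z (.inr j)) where
  hom := biprod.lift (biproduct.lift fun j ↦ biproduct.π Z (.inl j))
    (biproduct.lift fun j ↦ biproduct.π Z (.inr j))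
  inv := biprod.desc (biproduct.desc fun j ↦ biproduct.ι Z (.inl j))
    (biproduct.desc fun j ↦ biproduct.ι Z (.inr j))
  hom_inv_id := by
    rw [biprod.lift_desc, biproduct.lift_desc, biproduct.lift_desc, ← biproduct.total,
      Fintype.sum_sum_type]
  inv_hom_id := by
    apply biprod.hom_ext' <;> apply biprod.hom_ext <;> ext j j' <;> simp [biproduct.ι_π]

variable {D : Type u} [Category.{v} D] [Abelian D]

/-- The cokernel of the split monomorphism `s` is a complement of `Y` in `X`, so it vanishes by
indecomposability. -/
lemma isIso_of_indecomposable {X Y : D} (hX : Indecomposable X) (hY : ¬ IsZero Y)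
    (s : Y ⟶ X) (r : X ⟶ Y) (h : s ≫ r = 𝟙 Y) : r ≫ s = 𝟙 X := by
  have : Mono s := mono_of_mono_fac h
  let E := ShortComplex.mk s (cokernel.π s) (cokernel.condition s)
  let σ : E.Splitting := ShortComplex.Splitting.ofExactOfRetraction E
    (shortExact_cokernel s).exact r h inferInstance
  have hZ : IsZero (cokernel s) := ((hX.2 _ _ σ.isoBinaryBiproduct).resolve_left hY)
  have : σ.s = 0 := hZ.eq_of_src _ _
  have hid := σ.id
  rw [this, comp_zero, add_zero] at hid
  exact hid

/-- An idempotent splits through its image, which is therefore zero or all of `X`. -/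
lemma eq_zero_or_one_of_indecomposable {X : D} (hX : Indecomposable X) (e : X ⟶ X)
    (he : e ≫ e = e) : e = 0 ∨ e = 𝟙 X := by
  have fac : factorThruImage e ≫ image.ι e = e := image.fac e
  have h : image.ι e ≫ factorThruImage e = 𝟙 _ := by
    rw [← cancel_epi (factorThruImage e), ← cancel_mono (image.ι e)]
    simp only [Category.assoc, fac, Category.comp_id]
    rw [← Category.assoc, fac, he]
  by_cases h0 : IsZero (image e)
  · left
    rw [← fac, h0.eq_of_src (image.ι e) 0, comp_zero]
  · right
    rw [← fac]
    exact isIso_of_indecomposable hX h0 _ _ h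

end Indecomposable

/-! ### Fitting's lemma and decompositions into indecomposables -/

section FiniteDimensional

/-- Fitting's lemma in polynomial form. Write the minimal polynomial of `x` as X ^ n * q with X not
dividing q. A Bézout relation between a power of X and q yields an idempotent polynomial in `x`; if
it is 0 then `x` is nilpotent, if it is 1 then `x` is invertible. -/
lemma isUnit_or_isNilpotent_of_idempotents {k A : Type*} [Field k] [Ring A] [Algebra k A]
    [Module.Finite k A] (hA : ∀ e : A, e * e = e → e = 0 ∨ e = 1) (x : A) :
    IsUnit x ∨ IsNilpotent x := by
  open Polynomial in
  have hx : IsIntegral k x := Algebra.IsIntegral.isIntegral x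
  have hm : minpoly k x ≠ 0 := minpoly.ne_zero hx
  obtain ⟨q, hq, hq'⟩ := exists_eq_pow_rootMultiplicity_mul_and_not_dvd _ hm 0
  set n := (minpoly k x).rootMultiplicity 0
  rw [C_0, sub_zero] at hq hq'
  -- The exponent `n + 1` instead of `n` ensures that a factor `x` can be split off the idempotent
  -- even when `n = 0`.
  have hco : IsCoprime ((X : k[X]) ^ (n + 1)) q :=
    ((Polynomial.prime_X.irreducible.coprime_iff_not_dvd).2 hq').pow_left
  obtain ⟨a, b, hab⟩ := hco
  have hzero : aeval x (X ^ (n + 1) * q) = 0 := by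
    rw [pow_succ', mul_assoc, ← hq, map_mul, minpoly.aeval, mul_zero]
  have hsum : aeval x (a * X ^ (n + 1)) + aeval x (b * q) = 1 := by
    rw [← map_add, hab, map_one]
  have hprod : aeval x (a * X ^ (n + 1)) * aeval x (b * q) = 0 := by
    rw [← map_mul, show a * X ^ (n + 1) * (b * q) = a * b * (X ^ (n + 1) * q) by ring, map_mul,
      hzero, mul_zero]
  have hidem : aeval x (a * X ^ (n + 1)) * aeval x (a * X ^ (n + 1)) =
      aeval x (a * X ^ (n + 1)) := by
    conv_rhs => rw [← mul_one (aeval x (a * X ^ (n + 1))), ← hsum, mul_add, hprod, add_zero]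
  rcases hA _ hidem with h | h
  · right
    refine ⟨n + 1, ?_⟩
    rw [h, zero_add] at hsum
    have : aeval x (X ^ (n + 1) * (b * q)) = 0 := by
      rw [show X ^ (n + 1) * (b * q) = b * (X ^ (n + 1) * q) by ring, map_mul, hzero, mul_zero]
    rw [map_mul, hsum, mul_one] at this
    simpa using this
  · left
    have h1 : aeval x (a * X ^ n) * x = 1 := by
      rw [← h, pow_succ, ← mul_assoc, map_mul _ (a * X ^ n), aeval_X]
    have h2 : x * aeval x (a * X ^ n) = 1 := by
      rw [← h1]
      conv_lhs => enter [1]; rw [← aeval_X (R := k) x]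
      conv_rhs => enter [2]; rw [← aeval_X (R := k) x]
      rw [← map_mul, ← map_mul, mul_comm]
    exact ⟨⟨x, _, h2, h1⟩, rfl⟩

variable {D : Type u} [Category.{v} D] [Abelian D] {k : Type v} [Field k] [Linear k D]

lemma exists_indecomposable_decomposition (hfin : ∀ X : D, Module.Finite k (X ⟶ X)) (M : D) :
    ∃ (r : ℕ) (X : Fin r → D), (∀ j, Indecomposable (X j)) ∧ Nonempty (M ≅ ⨁ X) := by
  induction hd : Module.finrank k (M ⟶ M) using Nat.strong_induction_on generalizing M with
  | _ d ih =>
  by_cases hM : IsZero M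
  · refine ⟨0, Fin.elim0, fun j ↦ j.elim0, ⟨hM.iso ?_⟩⟩
    rw [IsZero.iff_id_eq_zero]
    ext j
    exact j.elim0
  by_cases hI : Indecomposable M
  · refine ⟨1, fun _ ↦ M, fun _ ↦ hI, ⟨(biproductUniqueIso (fun _ : Fin 1 ↦ M)).symm⟩⟩
  obtain ⟨Y, Z, e, hY, hZ⟩ : ∃ Y Z, ∃ _ : M ≅ Y ⊞ Z, ¬ IsZero Y ∧ ¬ IsZero Z := by
    by_contra! hcon
    refine hI ⟨hM, fun Y Z e ↦ ?_⟩
    by_cases hY : IsZero Y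
    · exact Or.inl hY
    · exact Or.inr (by simpa using hcon Y Z e hY)
  -- Induction on dim End M: f ↦ p f i embeds End A into End M and misses the identity, because
  -- every morphism in its range vanishes on the nonzero summand `B`.
  have key : ∀ (A B : D) (i : A ⟶ M) (p : M ⟶ A) (i' : B ⟶ M) (p' : M ⟶ B), i ≫ p = 𝟙 A →
      i' ≫ p' = 𝟙 B → i' ≫ p = 0 → ¬ IsZero B →
      Module.finrank k (A ⟶ A) < Module.finrank k (M ⟶ M) := by
    intro A B i p i' p' h h' h0 hB
    let φ : (A ⟶ A) →ₗ[k] (M ⟶ M) := (Linear.rightComp k M i).comp (Linear.leftComp k A p)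
    have hφ (f) : φ f = (p ≫ f) ≫ i := rfl
    have hinj : Function.Injective φ := fun f g hfg ↦ by
      have := congrArg (fun x ↦ i ≫ x ≫ p) hfg
      simpa [hφ, h, reassoc_of% h] using this
    rw [← LinearMap.finrank_range_of_inj hinj]
    refine Submodule.finrank_lt fun htop ↦ hB ?_
    obtain ⟨f, hf⟩ : 𝟙 M ∈ LinearMap.range φ := htop ▸ Submodule.mem_top
    rw [IsZero.iff_id_eq_zero, ← h', ← Category.id_comp p', ← hf, hφ]
    simp [reassoc_of% h0]
  obtain ⟨r, X, hX, ⟨eX⟩⟩ := ih _ (hd ▸ key Y Z (biprod.inl ≫ e.inv) (e.hom ≫ biprod.fst)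
    (biprod.inr ≫ e.inv) (e.hom ≫ biprod.snd) (by simp) (by simp) (by simp) hZ) Y rfl
  obtain ⟨s, X', hX', ⟨eX'⟩⟩ := ih _ (hd ▸ key Z Y (biprod.inr ≫ e.inv) (e.hom ≫ biprod.snd)
    (biprod.inl ≫ e.inv) (e.hom ≫ biprod.fst) (by simp) (by simp) (by simp) hY) Z rfl
  refine ⟨r + s, Sum.elim X X' ∘ finSumFinEquiv.symm, fun j ↦ ?_, ⟨e ≪≫ biprod.mapIso eX eX' ≪≫
    (biproductSumIso (Sum.elim X X')).symm ≪≫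
      (biproduct.whiskerEquiv finSumFinEquiv (fun j ↦ eqToIso (by simp)))⟩⟩
  rcases h : finSumFinEquiv.symm j with j | j
  · simpa [h] using hX j
  · simpa [h] using hX' j

end FiniteDimensional

end HighestWeight
end

noncomputable section
namespace HighestWeight
namespace HighestWeightCategory

variable {k : Type v} [Field k] {Λ : Type w} [PartialOrder Λ]
  {C : Type u} [Category.{v} C] [Abelian C] [Linear k C]
  (H : HighestWeightCategory k Λ C)

/-! ### Composition factors -/

/-- The objects all of whose simple subquotients are of the form `L c` with `c ∈ S`. -/
def factorsIn (S : Set Λ) : ObjectProperty C :=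
  fun X ↦ ∀ ⦃A : C⦄ ⦃c : Λ⦄ (m : A ⟶ X) (q : A ⟶ H.L c), Mono m → Epi q → c ∈ S

instance (S : Set Λ) : (H.factorsIn S).IsSerreClass where
  exists_zero := by
    refine ⟨(HasZeroObject.zero' C).zero, isZero_zero C, fun A c m q _ _ ↦ ?_⟩
    have := H.simple c
    have hA : IsZero A := IsZero.of_mono m (isZero_zero C)
    exact (Simple.not_isZero (H.L c) (IsZero.of_epi q hA)).elim
  prop_of_mono f _ hY A c m q _ hq := hY (m ≫ f) q inferInstance hq
  prop_of_epi f _ hX A c m q _ hq := hX (pullback.snd m f) (pullback.fst m f ≫ q)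
    inferInstance inferInstance
  prop_X₂_of_shortExact {E} hE h₁ h₃ A c m q _ _ := by
    have := H.simple c
    have := hE.mono_f
    by_cases h0 : pullback.fst m E.f ≫ q = 0
    -- If `q` vanishes on the part of `A` inside `E.X₁`, it factors through the image of `A` in
    -- `E.X₃`; otherwise `L c` is already a subquotient of `E.X₁`.
    · have hk : kernel.ι (m ≫ E.g) ≫ q = 0 := by
        obtain ⟨t, ht⟩ : ∃ t, t ≫ E.f = kernel.ι (m ≫ E.g) ≫ m :=
          ⟨hE.exact.lift (kernel.ι (m ≫ E.g) ≫ m) (by simp), by simp⟩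
        rw [← pullback.lift_fst (f := m) (g := E.f) (kernel.ι (m ≫ E.g)) t ht.symm,
          Category.assoc, h0, comp_zero]
      let q' : Abelian.coimage (m ≫ E.g) ⟶ H.L c := cokernel.desc _ q hk
      have : Epi q' := epi_of_epi_fac (cokernel.π_desc _ q hk)
      exact h₃ (Abelian.factorThruCoimage (m ≫ E.g)) q' inferInstance this
    · exact h₁ (pullback.snd m E.f) _ inferInstance (epi_of_nonzero_to_simple h0)

lemma factorsIn_L {S : Set Λ} {a : Λ} (ha : a ∈ S) : H.factorsIn S (H.L a) := by
  intro A c m q _ _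
  have := H.simple c
  have := H.simple a
  have hq0 : q ≠ 0 := fun h ↦ Simple.not_isZero (H.L c) (IsZero.of_epi_eq_zero q h)
  have hm0 : m ≠ 0 := fun h ↦ hq0 ((IsZero.of_mono_eq_zero m h).eq_of_src _ _)
  have : IsIso m := isIso_of_mono_of_nonzero hm0
  have h0 : inv m ≫ q ≠ 0 := fun h ↦ hq0 (by simpa using h)
  have := isIso_of_hom_simple h0
  rwa [← H.eq_of_iso a c ⟨asIso (inv m ≫ q)⟩]

lemma factorsIn_of_serreGenerated {S : Set Λ} {X : C} (hX : serreGenerated H.L S X) :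
    H.factorsIn S X :=
  hX _ inferInstance fun _ ha ↦ H.factorsIn_L ha

lemma mem_of_hasFiltration {S : Set Λ} {X : C} {l : List Λ} (hl : HasFiltration H.L X l)
    (hX : H.factorsIn S X) : ∀ a ∈ l, a ∈ S := by
  induction hl with
  | zero hM => simp
  | @step E hE l h b e ih =>
    have := hE.mono_f
    have := hE.epi_g
    intro a ha
    rcases List.mem_cons.1 ha with rfl | ha
    · exact hX (𝟙 _) (E.g ≫ e.hom) inferInstance inferInstance
    · exact ih ((H.factorsIn S).prop_of_mono E.f hX) a ha

lemma exists_filtration {S : Set Λ} {X : C} (hX : H.factorsIn S X) :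
    ∃ l, HasFiltration H.L X l ∧ ∀ a ∈ l, a ∈ S := by
  obtain ⟨l, hl⟩ := H.finiteLength X
  exact ⟨l, hl, H.mem_of_hasFiltration hl hX⟩

/-- Replaces the quantification over all Serre classes by a condition that can be tested on
subquotients. -/
lemma serreGenerated_iff {S : Set Λ} {X : C} : serreGenerated H.L S X ↔ H.factorsIn S X := by
  refine ⟨H.factorsIn_of_serreGenerated, fun h ↦ ?_⟩
  obtain ⟨l, hl, hS⟩ := H.exists_filtration h
  exact hl.prop _ fun a ha ↦ serreGenerated_of_mem H.L (hS a ha)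

lemma factorsIn_mono {S S' : Set Λ} (h : S ⊆ S') {X : C} (hX : H.factorsIn S X) :
    H.factorsIn S' X :=
  fun _ _ m q hm hq ↦ h (hX m q hm hq)

lemma factorsIn_Δ (a : Λ) : H.factorsIn (Set.Iic a) (H.Δ a) :=
  H.factorsIn_of_serreGenerated (H.Δ_mem a)

lemma factorsIn_nabla (a : Λ) : H.factorsIn (Set.Iic a) (H.nabla a) :=
  H.factorsIn_of_serreGenerated (H.nabla_mem a)

/-! ### Standard and costandard objects -/

instance epi_π (a : Λ) : Epi (H.π a) := by
  let P := serreGenerated H.L (Set.Iic a)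
  have := P.preservesEpimorphisms_ι_of_isNormalMonoCategory
  have := (H.isProjectiveCover a).epi
  exact inferInstanceAs (Epi (P.ι.map (P.homMk (H.π a) :
    (⟨H.Δ a, H.Δ_mem a⟩ : P.FullSubcategory) ⟶
      ⟨H.L a, serreGenerated_of_mem H.L Set.self_mem_Iic⟩)))

instance mono_incl (a : Λ) : Mono (H.incl a) := by
  let P := serreGenerated H.L (Set.Iic a)
  have := P.preservesMonomorphisms_ι_of_isNormalEpiCategory
  have := (H.isInjectiveHull a).mono
  exact inferInstanceAs (Mono (P.ι.map (P.homMk (H.incl a) :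
    (⟨H.L a, serreGenerated_of_mem H.L Set.self_mem_Iic⟩ : P.FullSubcategory) ⟶
      ⟨H.nabla a, H.nabla_mem a⟩)))

/-- `Z` need not lie in C_{≤ a}, but the image of `g` does, and essentiality of the projective cover
applies to it. -/
lemma epi_of_epi_comp_π {a : Λ} {Z : C} (g : Z ⟶ H.Δ a) (h : g ≫ H.π a ≠ 0) : Epi g := by
  let P := serreGenerated H.L (Set.Iic a)
  have := P.preservesEpimorphisms_ι_of_isNormalMonoCategory
  have := H.simple a
  suffices Epi (image.ι g) by rw [← image.fac g]; infer_instance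
  have h' : image.ι g ≫ H.π a ≠ 0 := fun h0 ↦ h (by rw [← image.fac g, Category.assoc, h0,
    comp_zero])
  have := epi_of_nonzero_to_simple h'
  let g' : (⟨image g, P.prop_of_mono (image.ι g) (H.Δ_mem a)⟩ : P.FullSubcategory) ⟶
    ⟨H.Δ a, H.Δ_mem a⟩ := P.homMk (image.ι g)
  have : Epi g' := (H.isProjectiveCover a).essential g' (P.ι.epi_of_epi_map this)
  exact inferInstanceAs (Epi (P.ι.map g'))

lemma mono_of_mono_incl_comp {a : Λ} {Z : C} (g : H.nabla a ⟶ Z) (h : H.incl a ≫ g ≠ 0) :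
    Mono g := by
  let P := serreGenerated H.L (Set.Iic a)
  have := P.preservesMonomorphisms_ι_of_isNormalEpiCategory
  have := H.simple a
  suffices Mono (factorThruImage g) by rw [← image.fac g]; infer_instance
  have h' : H.incl a ≫ factorThruImage g ≠ 0 := fun h0 ↦ h (by rw [← image.fac g,
    ← Category.assoc, h0, zero_comp])
  have := Preadditive.mono_of_kernel_zero (kernel_zero_of_nonzero_from_simple h')
  let g' : (⟨H.nabla a, H.nabla_mem a⟩ : P.FullSubcategory) ⟶
    ⟨image g, P.prop_of_epi (factorThruImage g) (H.nabla_mem a)⟩ := P.homMk (factorThruImage g)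
  have : Mono g' := (H.isInjectiveHull a).essential g' (P.ι.mono_of_mono_map this)
  exact inferInstanceAs (Mono (P.ι.map g'))

lemma Δ_lift {a : Λ} {X Y : C} (hX : H.factorsIn (Set.Iic a) X) (e : X ⟶ Y) [Epi e]
    (f : H.Δ a ⟶ Y) : ∃ g, g ≫ e = f := by
  let P := serreGenerated H.L (Set.Iic a)
  have hX' : P X := H.serreGenerated_iff.2 hX
  let e' : (⟨X, hX'⟩ : P.FullSubcategory) ⟶ ⟨Y, P.prop_of_epi e hX'⟩ := P.homMk e
  have : Epi e' := P.ι.epi_of_epi_map (inferInstanceAs (Epi e))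
  have := (H.isProjectiveCover a).projective
  let f' : (⟨H.Δ a, H.Δ_mem a⟩ : P.FullSubcategory) ⟶ ⟨Y, P.prop_of_epi e hX'⟩ := P.homMk f
  exact ⟨(Projective.factorThru f' e').hom,
    congrArg (fun x ↦ x.hom) (Projective.factorThru_comp f' e')⟩

lemma nabla_extend {a : Λ} {X Y : C} (hY : H.factorsIn (Set.Iic a) Y) (m : X ⟶ Y) [Mono m]
    (f : X ⟶ H.nabla a) : ∃ g, m ≫ g = f := by
  let P := serreGenerated H.L (Set.Iic a)
  have hY' : P Y := H.serreGenerated_iff.2 hY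
  let mP : (⟨X, P.prop_of_mono m hY'⟩ : P.FullSubcategory) ⟶ ⟨Y, hY'⟩ := P.homMk m
  have : Mono mP := P.ι.mono_of_mono_map (inferInstanceAs (Mono m))
  have := (H.isInjectiveHull a).injective
  let fP : (⟨X, P.prop_of_mono m hY'⟩ : P.FullSubcategory) ⟶ ⟨H.nabla a, H.nabla_mem a⟩ :=
    P.homMk f
  exact ⟨(Injective.factorThru fP mP).hom,
    congrArg (fun x ↦ x.hom) (Injective.comp_factorThru fP mP)⟩

/-- The canonical morphism `Δ a ⟶ ∇ a`. -/
def can (a : Λ) : H.Δ a ⟶ H.nabla a := H.π a ≫ H.incl a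

lemma can_ne_zero (a : Λ) : H.can a ≠ 0 := by
  have := H.simple a
  intro h
  refine Simple.not_isZero (H.L a) ?_
  rw [IsZero.iff_id_eq_zero, ← cancel_epi (H.π a), ← cancel_mono (H.incl a)]
  simpa [can] using h

lemma exists_smul_can {a : Λ} (f : H.Δ a ⟶ H.nabla a) : ∃ c : k, c • H.can a = f := by
  obtain ⟨e⟩ := H.hom_Δ_nabla a
  exact exists_smul_eq_of_finrank_eq_one (by rw [e.finrank_eq, Module.finrank_self])
    (H.can_ne_zero a) f

/-- The kernel of `f` must lie in that of `π a`: otherwise it would map onto `Δ a` by essentiality,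
and `f` would be zero. -/
lemma exists_image_to_L {a : Λ} {X : C} (f : H.Δ a ⟶ X) (hf : f ≠ 0) :
    ∃ q : image f ⟶ H.L a, factorThruImage f ≫ q = H.π a ∧ Epi q := by
  have hk : kernel.ι (factorThruImage f) ≫ H.π a = 0 := by
    by_contra h
    have := H.epi_of_epi_comp_π _ h
    refine hf ?_
    rw [← image.fac f, ← cancel_epi (kernel.ι (factorThruImage f)), kernel.condition_assoc,
      zero_comp, comp_zero]
  obtain ⟨q, hq⟩ : ∃ q : image f ⟶ H.L a, factorThruImage f ≫ q = H.π a :=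
    ⟨(shortExact_kernel (factorThruImage f)).exact.desc (H.π a) hk, by
      exact (shortExact_kernel (factorThruImage f)).exact.g_desc _ hk⟩
  exact ⟨q, hq, epi_of_epi_fac hq⟩

lemma mem_of_hom_Δ {S : Set Λ} {a : Λ} {X : C} (hX : H.factorsIn S X) (f : H.Δ a ⟶ X)
    (hf : f ≠ 0) : a ∈ S := by
  obtain ⟨q, -, hq⟩ := H.exists_image_to_L f hf
  exact hX (image.ι f) q inferInstance hq

lemma exists_L_to_image {a : Λ} {X : C} (f : X ⟶ H.nabla a) (hf : f ≠ 0) :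
    ∃ m : H.L a ⟶ image f, m ≫ image.ι f = H.incl a := by
  have hk : H.incl a ≫ cokernel.π (image.ι f) = 0 := by
    by_contra h
    have := H.mono_of_mono_incl_comp _ h
    refine hf ?_
    rw [← image.fac f, ← cancel_mono (cokernel.π (image.ι f)), Category.assoc, cokernel.condition,
      comp_zero, zero_comp]
  exact ⟨(shortExact_cokernel (image.ι f)).exact.lift (H.incl a) hk, by
      exact (shortExact_cokernel (image.ι f)).exact.lift_f _ hk⟩

lemma mem_of_hom_nabla {S : Set Λ} {a : Λ} {X : C} (hX : H.factorsIn S X) (f : X ⟶ H.nabla a)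
    (hf : f ≠ 0) : a ∈ S := by
  obtain ⟨m, hm⟩ := H.exists_L_to_image f hf
  have : Mono m := mono_of_mono_fac hm
  exact (H.factorsIn S).prop_of_epi (factorThruImage f) hX m (𝟙 _) inferInstance inferInstance

/-- If `L a` were a subquotient of the kernel, injectivity of `nabla a` would extend the resulting
nonzero map to a map `Δ a ⟶ nabla a`. All of these are multiples of `can a`, which vanishes on the
kernel. -/
lemma factorsIn_kernel_π (a : Λ) : H.factorsIn (Set.Iio a) (kernel (H.π a)) := by
  have hR : H.factorsIn (Set.Iic a) (kernel (H.π a)) :=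
    (H.factorsIn _).prop_of_mono (kernel.ι _) (H.factorsIn_Δ a)
  intro A c m q _ _
  refine lt_of_le_of_ne (hR m q inferInstance inferInstance) ?_
  rintro rfl
  obtain ⟨g, hg⟩ := H.nabla_extend hR m (q ≫ H.incl c)
  obtain ⟨g', rfl⟩ := H.nabla_extend (H.factorsIn_Δ c) (kernel.ι (H.π c)) g
  obtain ⟨r, rfl⟩ := H.exists_smul_can g'
  have := H.simple c
  refine Simple.not_isZero (H.L c) ?_
  rw [IsZero.iff_id_eq_zero, ← cancel_mono (H.incl c), ← cancel_epi q]
  simp [← hg, can]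

lemma factorsIn_cokernel_incl (a : Λ) : H.factorsIn (Set.Iio a) (cokernel (H.incl a)) := by
  have hQ : H.factorsIn (Set.Iic a) (cokernel (H.incl a)) :=
    (H.factorsIn _).prop_of_epi (cokernel.π _) (H.factorsIn_nabla a)
  intro A c m q _ _
  refine lt_of_le_of_ne (hQ m q inferInstance inferInstance) ?_
  rintro rfl
  obtain ⟨g, hg⟩ := H.Δ_lift ((H.factorsIn _).prop_of_mono m hQ) q (H.π c)
  obtain ⟨g', hg'⟩ := H.Δ_lift (H.factorsIn_nabla c) (cokernel.π (H.incl c)) (g ≫ m)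
  obtain ⟨r, rfl⟩ := H.exists_smul_can g'
  have hg0 : g = 0 := by
    rw [← cancel_mono m, ← hg']
    simp [can]
  have := H.simple c
  refine Simple.not_isZero (H.L c) ?_
  rw [IsZero.iff_id_eq_zero, ← cancel_epi (H.π c), ← hg, hg0]
  simp

/-- Reduce to `X = L c` and embed it into `nabla c`. The quotient has only factors below `c`, so it
receives a nonzero map from `Δ a` only if `a < c`. -/
lemma ext_Δ_left {a : Λ} {S : Set Λ} (hS : ∀ c ∈ S, ¬ a < c) {X : C} (hX : H.factorsIn S X) :
    Subsingleton (ExtGroup (H.Δ a) X 1) := by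
  obtain ⟨l, hl, hlS⟩ := H.exists_filtration hX
  refine hl.ext_right fun c hc ↦ ?_
  refine ext_X₁_right (shortExact_cokernel (H.incl c)) (H.ext_one a c) fun f ↦ ⟨0, ?_⟩
  by_contra! h
  exact hS c (hlS c hc) (Set.mem_Iio.1 (H.mem_of_hom_Δ (H.factorsIn_cokernel_incl c) f
    (by simpa using h.symm)))

lemma ext_nabla_right {a : Λ} {S : Set Λ} (hS : ∀ c ∈ S, ¬ a < c) {X : C}
    (hX : H.factorsIn S X) : Subsingleton (ExtGroup X (H.nabla a) 1) := by
  obtain ⟨l, hl, hlS⟩ := H.exists_filtration hX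
  refine hl.ext_left fun c hc ↦ ?_
  refine ext_X₃_left (shortExact_kernel (H.π c)) (H.ext_one c a) fun f ↦ ⟨0, ?_⟩
  by_contra! h
  exact hS c (hlS c hc) (Set.mem_Iio.1 (H.mem_of_hom_nabla (H.factorsIn_kernel_π c) f
    (by simpa using h.symm)))

end HighestWeightCategory
end HighestWeight
end

noncomputable section
namespace HighestWeight
namespace HighestWeightCategory

variable {k : Type v} [Field k] {Λ : Type w} [PartialOrder Λ]
  {C : Type u} [Category.{v} C] [Abelian C] [Linear k C]
  (H : HighestWeightCategory k Λ C)

/-! ### Objects with standard filtrations -/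

/-- The objects without first extensions by costandard objects. -/
def IsGood (X : C) : Prop := ∀ b, Subsingleton (ExtGroup X (H.nabla b) 1)

/-- The objects without first extensions of standard objects by them. -/
def IsCogood (Y : C) : Prop := ∀ a, Subsingleton (ExtGroup (H.Δ a) Y 1)

variable {H}

lemma IsGood.of_hasFiltration {X : C} {l : List Λ} (hX : HasFiltration H.Δ X l) : H.IsGood X :=
  fun b ↦ hX.ext_left fun a _ ↦ H.ext_one a b

lemma IsCogood.of_hasFiltration {X : C} {l : List Λ} (hX : HasFiltration H.nabla X l) :
    H.IsCogood X :=
  fun a ↦ hX.ext_right fun b _ ↦ H.ext_one a b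

lemma hom_eq_zero_of_hasFiltration {X Y : C} {l : List Λ} (hY : HasFiltration H.L Y l)
    (h : ∀ b ∈ l, ∀ f : X ⟶ H.L b, f = 0) (f : X ⟶ Y) : f = 0 := by
  induction hY with
  | zero hM => exact hM.eq_of_tgt _ _
  | @step E hE l _ b e ih =>
    have := hE.mono_f
    have h0 : f ≫ E.g = 0 := by
      rw [← cancel_mono e.hom, Category.assoc, h b List.mem_cons_self (f ≫ E.g ≫ e.hom), zero_comp]
    rw [← hE.exact.lift_f f h0,
      ih (fun c hc ↦ h c (List.mem_cons_of_mem _ hc)) (hE.exact.lift f h0), zero_comp]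

/-- Choose `b` minimal such that `X` maps nontrivially to `L b`. The obstruction to lifting this map
to `Δ b` lies in Ext¹ of `X` with the kernel of `π b`. It vanishes: the factors `L c` of the kernel
have `c < b`, and by minimality `X` has no maps to the factors of `nabla c` modulo `L c`. The lift
is epi because `π b` is essential. -/
lemma IsGood.exists_epi_Δ {X : C} (hX : H.IsGood X) (hX0 : ¬ IsZero X) {s : Finset Λ}
    (hs : H.factorsIn (s : Set Λ) X) : ∃ b ∈ s, ∃ g : X ⟶ H.Δ b, Epi g := by
  obtain ⟨b, ⟨hb, hmin⟩⟩ : ∃ b, Minimal (fun b ↦ b ∈ s ∧ ∃ f : X ⟶ H.L b, f ≠ 0) b := by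
    refine Set.Finite.exists_minimal (s := {b | b ∈ s ∧ ∃ f : X ⟶ H.L b, f ≠ 0})
      (s.finite_toSet.subset fun b hb ↦ hb.1) ?_
    obtain ⟨l, hl⟩ := H.finiteLength X
    cases hl with
    | zero hM => exact (hX0 hM).elim
    | @step E hE l h a e =>
      have := hE.epi_g
      have := H.simple a
      exact ⟨a, hs (𝟙 _) (E.g ≫ e.hom) inferInstance inferInstance, E.g ≫ e.hom, fun h0 ↦
        Simple.not_isZero (H.L a) (IsZero.of_epi_eq_zero _ h0)⟩
  obtain ⟨hbs, f, hf⟩ := hb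
  have hzero (c : Λ) (hc : c < b) (f : X ⟶ H.L c) : f = 0 := by
    by_contra hf
    have := H.simple c
    have := epi_of_nonzero_to_simple hf
    exact hc.not_ge (hmin ⟨hs (𝟙 _) f inferInstance inferInstance, f, hf⟩ hc.le)
  have hext : Subsingleton (ExtGroup X (kernel (H.π b)) 1) := by
    obtain ⟨l, hl, hlb⟩ := H.exists_filtration (H.factorsIn_kernel_π b)
    refine hl.ext_right fun c hc ↦ ?_
    refine ext_X₁_right (shortExact_cokernel (H.incl c)) (hX c) fun f ↦ ⟨0, ?_⟩
    obtain ⟨l', hl', hlc⟩ := H.exists_filtration (H.factorsIn_cokernel_incl c)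
    rw [zero_comp]
    exact (hom_eq_zero_of_hasFiltration hl'
      (fun d hd ↦ hzero d ((hlc d hd).trans (hlb c hc))) f).symm
  obtain ⟨g, hg⟩ := exists_lift (shortExact_kernel (H.π b)) hext f
  exact ⟨b, hbs, g, H.epi_of_epi_comp_π g (by rwa [show g ≫ H.π b = f from hg])⟩

/-- Split off a standard quotient `Δ b` and induct on the sum of the dimensions of Hom(X, ∇_c). The
kernel is again good by the vanishing of Ext², and the sum drops because `g ≫ can b` is a nonzero
map that dies on the kernel. -/
lemma IsGood.exists_hasFiltration {X : C} (hX : H.IsGood X) : ∃ l, HasFiltration H.Δ X l := by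
  classical
  obtain ⟨l, hl⟩ := H.finiteLength X
  obtain ⟨s, hs⟩ : ∃ s : Finset Λ, H.factorsIn (s : Set Λ) X :=
    ⟨l.toFinset, hl.prop _ fun a ha ↦ H.factorsIn_L (by simpa)⟩
  clear hl l
  induction hd : ∑ b ∈ s, Module.finrank k (X ⟶ H.nabla b) using Nat.strong_induction_on
    generalizing X with
  | _ d ih =>
  by_cases hX0 : IsZero X
  · exact ⟨[], .zero hX0⟩
  obtain ⟨b, hbs, g, _⟩ := hX.exists_epi_Δ hX0 hs
  have hE := shortExact_kernel g
  have hK : H.IsGood (kernel g) := fun c ↦ ext_X₁_left hE (hX c) (H.ext_two b c)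
  have hsurj (c : Λ) : Function.Surjective (Linear.leftComp k (H.nabla c) (kernel.ι g)) :=
    exists_extension hE (H.ext_one b c)
  have hfin (Y : C) (c : Λ) : Module.Finite k (Y ⟶ H.nabla c) := H.finite_hom _ _
  obtain ⟨l, hl⟩ := ih _ (by
    rw [← hd]
    refine Finset.sum_lt_sum (fun c _ ↦ LinearMap.finrank_le_finrank_of_surjective (hsurj c))
      ⟨b, hbs, ?_⟩
    rw [← LinearMap.finrank_range_add_finrank_ker (Linear.leftComp k (H.nabla b) (kernel.ι g)),
      LinearMap.range_eq_top.2 (hsurj b), finrank_top]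
    refine Nat.lt_add_of_pos_right (Module.finrank_pos_iff_exists_ne_zero.2
      ⟨⟨g ≫ H.can b, by simp⟩, fun h0 ↦ H.can_ne_zero b ?_⟩)
    rw [← cancel_epi g, comp_zero]
    exact congrArg Subtype.val h0) hK ((H.factorsIn _).prop_of_mono (kernel.ι g) hs) rfl
  exact ⟨b :: l, HasFiltration.step hE hl (Iso.refl _)⟩

lemma IsGood.ext_one {X Y : C} (hX : H.IsGood X) (hY : H.IsCogood Y) :
    Subsingleton (ExtGroup X Y 1) := by
  obtain ⟨l, hl⟩ := hX.exists_hasFiltration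
  exact hl.ext_left fun a _ ↦ hY a

lemma IsGood.X₁ {E : ShortComplex C} (hE : E.ShortExact) (h₂ : H.IsGood E.X₂)
    (h₃ : H.IsGood E.X₃) : H.IsGood E.X₁ := by
  obtain ⟨l, hl⟩ := h₃.exists_hasFiltration
  exact fun b ↦ ext_X₁_left hE (h₂ b) (hl.ext_left fun a _ ↦ H.ext_two a b)

lemma IsGood.of_isZero {X : C} (hX : IsZero X) : H.IsGood X :=
  fun _ ↦ ext_of_isZero_left hX

lemma IsGood.of_iso {X Y : C} (hX : H.IsGood X) (e : X ≅ Y) : H.IsGood Y :=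
  fun b ↦ ext_of_retract_left e.inv e.hom e.inv_hom_id (hX b)

lemma isGood_Δ (a : Λ) : H.IsGood (H.Δ a) := H.ext_one a

/-- A standard factor of maximal weight can be moved to the bottom of the filtration, since it has
no first extensions with the factors below it. -/
lemma exists_Δ_mono {X : C} {l : List Λ} (hX : HasFiltration H.Δ X l) {a : Λ} (ha : a ∈ l)
    (hmax : ∀ c ∈ l, ¬ a < c) :
    ∃ i : H.Δ a ⟶ X, Mono i ∧ H.IsGood (cokernel i) := by
  -- Extendability of all maps to costandard objects implies goodness of the cokernel and passes
  -- directly from `E.X₁` to `E.X₂` in the induction.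
  suffices ∃ i : H.Δ a ⟶ X, Mono i ∧ ∀ b (f : H.Δ a ⟶ H.nabla b), ∃ g, i ≫ g = f by
    obtain ⟨i, hi, h⟩ := this
    exact ⟨i, hi, fun b ↦ ext_X₃_left (shortExact_cokernel i) (IsGood.of_hasFiltration hX b) (h b)⟩
  induction hX with
  | zero hM => simp at ha
  | @step E hE l h b e ih =>
    have := hE.mono_f
    rcases List.mem_cons.1 ha with rfl | ha
    · have hE₁ : H.factorsIn {c | ¬ a < c} E.X₁ := h.prop _ fun c hc ↦
        H.factorsIn_mono (fun d (hd : d ≤ c) (hda : a < d) ↦ hmax c (List.mem_cons_of_mem _ hc)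
          (hda.trans_le hd)) (H.factorsIn_Δ c)
      obtain ⟨i, hi⟩ := exists_lift hE (H.ext_Δ_left (fun c hc ↦ hc) hE₁) e.inv
      have hi' : i ≫ E.g ≫ e.hom = 𝟙 _ := by rw [reassoc_of% hi, e.inv_hom_id]
      exact ⟨i, mono_of_mono_fac hi', fun b f ↦ ⟨E.g ≫ e.hom ≫ f, by
        rw [← Category.assoc E.g, ← Category.assoc, hi', Category.id_comp]⟩⟩
    · obtain ⟨i, hi, hext⟩ := ih ha fun c hc ↦ hmax c (List.mem_cons_of_mem _ hc)
      refine ⟨i ≫ E.f, inferInstance, fun c f ↦ ?_⟩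
      obtain ⟨g, rfl⟩ := hext c f
      obtain ⟨g', rfl⟩ := exists_extension hE
        (ext_of_retract_left e.hom e.inv e.hom_inv_id (H.ext_one b c)) g
      exact ⟨g', Category.assoc _ _ _⟩

lemma exists_nabla_epi {X : C} {l : List Λ} (hX : HasFiltration H.nabla X l) {b : Λ} (hb : b ∈ l)
    (hmax : ∀ c ∈ l, ¬ b < c) :
    ∃ p : X ⟶ H.nabla b, Epi p ∧ H.IsCogood (kernel p) := by
  suffices ∃ p : X ⟶ H.nabla b, Epi p ∧ ∀ a (f : H.Δ a ⟶ H.nabla b), ∃ g, g ≫ p = f by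
    obtain ⟨p, hp, h⟩ := this
    exact ⟨p, hp, fun a ↦ ext_X₁_right (shortExact_kernel p) (IsCogood.of_hasFiltration hX a) (h a)⟩
  induction hX with
  | zero hM => simp at hb
  | @step E hE l h a e ih =>
    have := hE.epi_g
    rcases List.mem_cons.1 hb with rfl | hb
    · refine ⟨E.g ≫ e.hom, inferInstance, fun a f ↦ ?_⟩
      obtain ⟨g, hg⟩ := exists_lift hE (IsCogood.of_hasFiltration h a) (f ≫ e.inv)
      exact ⟨g, by rw [reassoc_of% hg, e.inv_hom_id, Category.comp_id]⟩
    · obtain ⟨p, hp, hlift⟩ := ih hb fun c hc ↦ hmax c (List.mem_cons_of_mem _ hc)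
      have hE₃ : H.factorsIn {c | ¬ b < c} (H.nabla a) :=
        H.factorsIn_mono (fun d (hd : d ≤ a) (hda : b < d) ↦ hmax a List.mem_cons_self
          (hda.trans_le hd)) (H.factorsIn_nabla a)
      obtain ⟨g, hg⟩ := exists_extension hE (ext_of_retract_left e.hom e.inv e.hom_inv_id
        (H.ext_nabla_right (fun c hc ↦ hc) hE₃)) p
      refine ⟨g, epi_of_epi_fac hg, fun c f ↦ ?_⟩
      obtain ⟨t, rfl⟩ := hlift c f
      exact ⟨t ≫ E.f, by rw [Category.assoc, hg]⟩

/-! ### Indecomposable tilting objects -/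

lemma mem_of_Δ_filtration {S : Set Λ} {X : C} {l : List Λ} (hl : HasFiltration H.Δ X l)
    (hX : H.factorsIn S X) : ∀ a ∈ l, a ∈ S := by
  induction hl with
  | zero hM => simp
  | @step E hE l h b e ih =>
    have := hE.mono_f
    have := hE.epi_g
    intro a ha
    rcases List.mem_cons.1 ha with rfl | ha
    · exact hX (𝟙 _) (E.g ≫ e.hom ≫ H.π a) inferInstance inferInstance
    · exact ih ((H.factorsIn S).prop_of_mono E.f hX) a ha

lemma mem_of_nabla_filtration {S : Set Λ} {X : C} {l : List Λ} (hl : HasFiltration H.nabla X l)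
    (hX : H.factorsIn S X) : ∀ a ∈ l, a ∈ S := by
  induction hl with
  | zero hM => simp
  | @step E hE l h b e ih =>
    have := hE.mono_f
    have := hE.epi_g
    intro a ha
    rcases List.mem_cons.1 ha with rfl | ha
    · exact (H.factorsIn S).prop_of_epi (E.g ≫ e.hom) hX (H.incl a) (𝟙 _) inferInstance
        inferInstance
    · exact ih ((H.factorsIn S).prop_of_mono E.f hX) a ha

open scoped Classical in
-- Hom out of `Δ a` is left exact, and only the factors `L a` contribute, each at most 1 because
-- Hom(Δ_a, L_a) embeds into Hom(Δ_a, ∇_a).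
lemma finrank_hom_Δ_le (a : Λ) {X : C} {l : List Λ} (hl : HasFiltration H.L X l) :
    Module.finrank k (H.Δ a ⟶ X) ≤ l.count a := by
  have hfin (X Y : C) : Module.Finite k (X ⟶ Y) := H.finite_hom X Y
  induction hl with
  | zero hM =>
    have : Subsingleton (H.Δ a ⟶ _) := ⟨fun f g ↦ hM.eq_of_tgt f g⟩
    simp [Module.finrank_zero_of_subsingleton]
  | @step E hE l h b e ih =>
    have := hE.mono_f
    rw [← LinearMap.finrank_range_add_finrank_ker (Linear.rightComp k (H.Δ a) (E.g ≫ e.hom)),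
      List.count_cons, add_comm]
    refine Nat.add_le_add ?_ ?_
    · refine le_trans (Submodule.finrank_mono (t := LinearMap.range
        (Linear.rightComp k (H.Δ a) E.f)) fun f hf ↦ ?_) ((LinearMap.finrank_range_le _).trans ih)
      have hf : f ≫ E.g = 0 := by
        rw [← cancel_mono e.hom, zero_comp, Category.assoc]
        exact hf
      exact ⟨hE.exact.lift f hf, hE.exact.lift_f f hf⟩
    · refine (Submodule.finrank_le _).trans ?_
      split_ifs with hab
      · obtain rfl : b = a := by simpa using hab
        obtain ⟨e⟩ := H.hom_Δ_nabla b
        rw [← Module.finrank_self k, ← e.finrank_eq]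
        exact LinearMap.finrank_le_finrank_of_injective
          (f := Linear.rightComp k (H.Δ b) (H.incl b)) fun f g hfg ↦ (cancel_mono _).1 hfg
      · have : Subsingleton (H.Δ a ⟶ H.L b) := by
          refine subsingleton_of_forall_eq 0 fun f ↦ ?_
          by_contra hf
          exact hab (by
            simpa using (H.mem_of_hom_Δ (H.factorsIn_L (Set.mem_singleton b)) f hf).symm)
        simp [Module.finrank_zero_of_subsingleton]

/-- The morphisms `Δ a ⟶ M ⟶ ∇ a` that exhibit `M` as the indecomposable tilting object of highest
weight `a`. -/
structure IsTiltingFactorization (a : Λ) {M : C} (i : H.Δ a ⟶ M) (p : M ⟶ H.nabla a) : Prop where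
  mono : Mono i
  epi : Epi p
  good : H.IsGood (cokernel i)
  cogood : H.IsCogood (kernel p)
  ne_zero : i ≫ p ≠ 0
  exists_smul : ∀ f : H.Δ a ⟶ M, ∃ c : k, c • i = f

/-- Since `L a` occurs in `M`, the weight `a` occurs in both filtrations, and it is maximal there.
Multiplicity one makes Hom(Δ_a, M) a line. -/
lemma IsIndecomposableTilting.exists_factorization {a : Λ} {M : C}
    (hM : H.IsIndecomposableTilting a M) :
    ∃ (i : H.Δ a ⟶ M) (p : M ⟶ H.nabla a), IsTiltingFactorization a i p := by
  classical
  have hMa := H.factorsIn_of_serreGenerated hM.mem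
  obtain ⟨l, hl, hcount⟩ := hM.multiplicity
  have hal : a ∈ l := List.count_pos_iff.1 (by convert Nat.one_pos)
  have hnot : ¬ H.factorsIn (Set.Iio a) M := fun h ↦
    lt_irrefl a (H.mem_of_hasFiltration hl h a hal)
  have hmem {l' : List Λ} (hl' : ∀ b ∈ l', b ≤ a) (h : (∀ b ∈ l', b < a) → False) : a ∈ l' := by
    by_contra ha
    exact h fun b hb ↦ lt_of_le_of_ne (hl' b hb) fun hab ↦ ha (hab ▸ hb)
  obtain ⟨⟨l₁, hl₁⟩, ⟨l₂, hl₂⟩⟩ := hM.tilting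
  have h₁ := mem_of_Δ_filtration hl₁ hMa
  have h₂ := mem_of_nabla_filtration hl₂ hMa
  obtain ⟨i, hi, hig⟩ := exists_Δ_mono hl₁ (hmem h₁ fun h ↦ hnot (hl₁.prop _ fun b hb ↦
    H.factorsIn_mono (Set.Iic_subset_Iio.2 (h b hb)) (H.factorsIn_Δ b)))
    fun c hc ↦ (h₁ c hc).not_gt
  obtain ⟨p, hp, hpg⟩ := exists_nabla_epi hl₂ (hmem h₂ fun h ↦ hnot (hl₂.prop _ fun b hb ↦
    H.factorsIn_mono (Set.Iic_subset_Iio.2 (h b hb)) (H.factorsIn_nabla b)))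
    fun c hc ↦ (h₂ c hc).not_gt
  have := H.finite_hom (H.Δ a) M
  have hi0 : i ≠ 0 := by
    rintro rfl
    exact H.can_ne_zero a ((IsZero.of_mono_eq_zero (0 : H.Δ a ⟶ M) rfl).eq_of_src _ _)
  have hspan (f : H.Δ a ⟶ M) : ∃ c : k, c • i = f := by
    refine exists_smul_eq_of_finrank_eq_one (le_antisymm ?_ ?_) hi0 f
    · exact (finrank_hom_Δ_le a hl).trans (le_of_eq (by convert hcount))
    · exact Module.finrank_pos_iff_exists_ne_zero.2 ⟨i, hi0⟩
  refine ⟨i, p, hi, hp, hig, hpg, fun h0 ↦ ?_, hspan⟩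
  -- `can a` lifts along `p` to a multiple of `i`, so `i ≫ p = 0` would make it zero.
  obtain ⟨g, hg⟩ := exists_lift (shortExact_kernel p) (hpg a) (H.can a)
  obtain ⟨c, rfl⟩ := hspan g
  exact H.can_ne_zero a (by rw [← hg]; simp [h0])

/-- `f` acts on the line spanned by `i` through a scalar. A nilpotent `f` would have scalar 0, hence
`i ≫ f = 0`; so `f` is a unit by Fitting's lemma. -/
lemma IsTiltingFactorization.isIso {a : Λ} {M : C} {i : H.Δ a ⟶ M} {p : M ⟶ H.nabla a}
    (h : IsTiltingFactorization a i p) (hM : Indecomposable M) (f : M ⟶ M)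
    (hf : i ≫ f ≫ p ≠ 0) : IsIso f := by
  have : Module.Finite k (End M) := H.finite_hom M M
  rcases isUnit_or_isNilpotent_of_idempotents (k := k) (A := End M)
    (eq_zero_or_one_of_indecomposable hM) f with hu | ⟨n, hn⟩
  · exact (isUnit_iff_isIso f).1 hu
  · obtain ⟨c, hc⟩ := h.exists_smul (i ≫ f)
    have hpow (m : ℕ) : i ≫ ((show End M from f) ^ m : End M) = c ^ m • i := by
      induction m with
      | zero =>
        rw [pow_zero, pow_zero, one_smul]
        exact Category.comp_id i
      | succ m ih => rw [pow_succ, End.mul_def, ← Category.assoc, ← hc, Linear.smul_comp, ih,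
          smul_smul, pow_succ']
    have hc0 : c ^ n • i = 0 := by rw [← hpow, hn, comp_zero]
    have : c ^ n • (i ≫ p) = 0 := by rw [← Linear.smul_comp, hc0, zero_comp]
    rcases smul_eq_zero.1 this with h0 | h0
    · refine (hf ?_).elim
      rw [← Category.assoc, ← hc, eq_zero_of_pow_eq_zero h0, zero_smul, zero_comp]
    · exact (h.ne_zero h0).elim

lemma IsTiltingFactorization.exists_extend {a : Λ} {M : C} {i : H.Δ a ⟶ M} {p : M ⟶ H.nabla a}
    (h : IsTiltingFactorization a i p) {X : C} (hX : H.IsCogood X) (g : H.Δ a ⟶ X) :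
    ∃ s : M ⟶ X, i ≫ s = g :=
  have := h.mono
  exists_extension (shortExact_cokernel i) (h.good.ext_one hX) g

lemma IsTiltingFactorization.exists_lift {a : Λ} {M : C} {i : H.Δ a ⟶ M} {p : M ⟶ H.nabla a}
    (h : IsTiltingFactorization a i p) {X : C} (hX : H.IsGood X) (g : X ⟶ H.nabla a) :
    ∃ r : X ⟶ M, r ≫ p = g :=
  have := h.epi
  HighestWeight.exists_lift (shortExact_kernel p) (hX.ext_one h.cogood) g

/-- Extend `g` and lift `h` through `M`; the composite endomorphism of `M` is invertible because it
is nonzero between `Δ a` and `nabla a`. -/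
lemma IsIndecomposableTilting.exists_retract {a : Λ} {M : C} (hM : H.IsIndecomposableTilting a M)
    {X : C} (hX : H.IsGood X) (hX' : H.IsCogood X) (g : H.Δ a ⟶ X) (h : X ⟶ H.nabla a)
    (hgh : g ≫ h ≠ 0) : ∃ (s : M ⟶ X) (r : X ⟶ M), s ≫ r = 𝟙 M := by
  obtain ⟨i, p, hip⟩ := hM.exists_factorization
  obtain ⟨s, rfl⟩ := hip.exists_extend hX' g
  obtain ⟨r, rfl⟩ := hip.exists_lift hX h
  have := hip.isIso hM.indecomposable (s ≫ r) (by simpa using hgh)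
  exact ⟨s, r ≫ inv (s ≫ r), by rw [← Category.assoc, IsIso.hom_inv_id]⟩

lemma isGood_of_isTilting {X : C} (hX : H.isTilting X) : H.IsGood X :=
  let ⟨_, hl⟩ := hX.1
  .of_hasFiltration hl

lemma isCogood_of_isTilting {X : C} (hX : H.isTilting X) : H.IsCogood X :=
  let ⟨_, hl⟩ := hX.2
  .of_hasFiltration hl

lemma isZero_of_isUnit_mem_jacobson {D : Type*} [Category D] [Preadditive D] {Z : D} {f : End Z}
    (hf : f ∈ Ring.jacobson (End Z)) (hu : IsUnit f) : IsZero Z := by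
  rw [IsZero.iff_id_eq_zero]
  by_contra h
  have : Nontrivial (End Z) := ⟨𝟙 Z, 0, h⟩
  exact (Module.jacobson_lt_top (End Z) (End Z)).ne (Ideal.eq_top_of_isUnit_mem _ hf hu)

/-- A nonzero composite would produce, through `d`, an automorphism of `M` lying in the Jacobson
radical of its endomorphism ring. -/
lemma IsIndecomposableTilting.comp_radical_comp {a : Λ} {M : C}
    (hM : H.IsIndecomposableTilting a M) {X Y : H.Tilt} {d : X ⟶ Y} (hd : InRadical d)
    (g : H.Δ a ⟶ X.obj) (h : Y.obj ⟶ H.nabla a) : g ≫ d.hom ≫ h = 0 := by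
  by_contra hgh
  obtain ⟨i, p, hip⟩ := hM.exists_factorization
  obtain ⟨s, rfl⟩ := hip.exists_extend (isCogood_of_isTilting X.property) g
  obtain ⟨r, rfl⟩ := hip.exists_lift (isGood_of_isTilting Y.property) h
  have h1 := hip.isIso hM.indecomposable (s ≫ d.hom ≫ r) (by simpa using hgh)
  let Z : H.Tilt := ⟨M, hM.tilting⟩
  let s' : Z ⟶ X := H.isTilting.homMk s
  let r' : Y ⟶ Z := H.isTilting.homMk r
  have h2 : IsIso (s' ≫ d ≫ r') := by
    have : IsIso (H.isTilting.ι.map (s' ≫ d ≫ r')) := h1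
    exact isIso_of_reflects_iso _ H.isTilting.ι
  have h3 : IsZero Z := isZero_of_isUnit_mem_jacobson (hd Z s' r') ((isUnit_iff_isIso _).2 h2)
  rw [IsZero.iff_id_eq_zero] at h3
  exact hM.indecomposable.1 ((IsZero.iff_id_eq_zero _).2 (congrArg (fun x ↦ x.hom) h3))

end HighestWeightCategory
end HighestWeight
end

noncomputable section
namespace HighestWeight

/-! ### Multiplicities of indecomposable tilting summands -/

section Pairing

variable (k : Type*) [Field k] {D : Type*} [Category D] [Preadditive D] [Linear k D]

/-- The kernel of the pairing `Hom(P, X) × Hom(X, N) → Hom(P, N)` in the second variable. -/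
def pairingKernel (P N X : D) : Submodule k (X ⟶ N) where
  carrier := {h | ∀ g : P ⟶ X, g ≫ h = 0}
  add_mem' h h' g := by simp [h g, h' g]
  zero_mem' := by simp
  smul_mem' c h hh g := by simp [hh g]

variable {k}

/-- The pairing commutes with finite direct sums. -/
def pairingQuotientEquiv (P N : D) {r : ℕ} (X : Fin r → D) {M : D}
    [HasFiniteBiproducts D] (e : M ≅ ⨁ X) :
    ((M ⟶ N) ⧸ pairingKernel k P N M) ≃ₗ[k] ∀ j, (X j ⟶ N) ⧸ pairingKernel k P N (X j) :=
  (Submodule.Quotient.equiv _ (Submodule.pi Set.univ fun j ↦ pairingKernel k P N (X j))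
    { toFun h j := biproduct.ι X j ≫ e.inv ≫ h
      map_add' h h' := by ext; simp
      map_smul' c h := by ext; simp
      invFun h := e.hom ≫ biproduct.desc h
      left_inv h := by
        rw [← cancel_epi e.inv, e.inv_hom_id_assoc]
        ext
        simp
      right_inv h := by ext; simp } (by
    apply le_antisymm
    · rintro _ ⟨h, hh, rfl⟩ j - g
      simpa using hh (g ≫ biproduct.ι X j ≫ e.inv)
    · intro h hh
      refine ⟨e.hom ≫ biproduct.desc h, fun g ↦ ?_, by ext; simp⟩
      rw [← Category.assoc, ← Category.comp_id (g ≫ e.hom), ← biproduct.total, Preadditive.comp_sum,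
        Preadditive.sum_comp]
      refine Finset.sum_eq_zero fun j _ ↦ ?_
      simpa using hh j trivial (g ≫ e.hom ≫ biproduct.π X j))).trans
  (Submodule.quotientPi _)

end Pairing

namespace HighestWeightCategory

variable {k : Type v} [Field k] {Λ : Type w} [PartialOrder Λ]
  {C : Type u} [Category.{v} C] [Abelian C] [Linear k C]
  {H : HighestWeightCategory k Λ C}

open scoped Classical in
-- On `M` itself the pairing is evaluation on the single generator of Hom(Δ_a, M), onto a line. On
-- any other indecomposable a nonzero value would split off `M`.
lemma IsIndecomposableTilting.finrank_pairing {a : Λ} {M : C} (hM : H.IsIndecomposableTilting a M)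
    {X : C} (hX : H.IsGood X) (hX' : H.IsCogood X) (hXi : Indecomposable X) :
    Module.finrank k ((X ⟶ H.nabla a) ⧸ pairingKernel k (H.Δ a) (H.nabla a) X) =
      if Nonempty (X ≅ M) then 1 else 0 := by
  split_ifs with h
  · obtain ⟨e⟩ := h
    obtain ⟨i, p, hip⟩ := hM.exists_factorization
    let φ := Linear.leftComp k (H.nabla a) (i ≫ e.inv)
    have hφ (f : X ⟶ H.nabla a) : φ f = (i ≫ e.inv) ≫ f := rfl
    have hker : pairingKernel k (H.Δ a) (H.nabla a) X = LinearMap.ker φ := by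
      ext f
      refine ⟨fun hf ↦ hf _, fun hf g ↦ ?_⟩
      obtain ⟨c, hc⟩ := hip.exists_smul (g ≫ e.hom)
      have : g = c • (i ≫ e.inv) := by
        rw [← Linear.smul_comp, hc, Category.assoc, e.hom_inv_id, Category.comp_id]
      rw [this, Linear.smul_comp, ← hφ, LinearMap.mem_ker.1 hf, smul_zero]
    have hsurj : Function.Surjective φ := fun f ↦ by
      obtain ⟨c, hc⟩ := H.exists_smul_can (i ≫ p)
      have hc0 : c ≠ 0 := by
        rintro rfl
        exact hip.ne_zero (by rw [← hc, zero_smul])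
      obtain ⟨c', rfl⟩ := H.exists_smul_can f
      refine ⟨(c' * c⁻¹) • (e.hom ≫ p), ?_⟩
      rw [map_smul, hφ, Category.assoc, e.inv_hom_id_assoc, ← hc, smul_smul,
        inv_mul_cancel_right₀ hc0]
    obtain ⟨e'⟩ := H.hom_Δ_nabla a
    rw [hker, (φ.quotKerEquivOfSurjective hsurj).finrank_eq, e'.finrank_eq, Module.finrank_self]
  · suffices pairingKernel k (H.Δ a) (H.nabla a) X = ⊤ by
      rw [this]
      exact Module.finrank_zero_of_subsingleton
    refine eq_top_iff.2 fun f _ g ↦ ?_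
    by_contra hgf
    obtain ⟨s, r, hsr⟩ := hM.exists_retract hX hX' g f hgf
    exact h ⟨⟨r, s, isIso_of_indecomposable hXi hM.indecomposable.1 s r hsr, hsr⟩⟩

lemma IsGood.of_retract {X Y : C} (hX : H.IsGood X) (i : Y ⟶ X) (r : X ⟶ Y) (h : i ≫ r = 𝟙 Y) :
    H.IsGood Y :=
  fun b ↦ ext_of_retract_left i r h (hX b)

lemma IsCogood.of_retract {X Y : C} (hX : H.IsCogood X) (i : Y ⟶ X) (r : X ⟶ Y)
    (h : i ≫ r = 𝟙 Y) : H.IsCogood Y :=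
  fun b ↦ ext_of_retract_right i r h (hX b)

lemma exists_decomposition (H : HighestWeightCategory k Λ C) (X : C) :
    ∃ (r : ℕ) (Y : Fin r → C), (∀ j, Indecomposable (Y j)) ∧ Nonempty (X ≅ ⨁ Y) :=
  exists_indecomposable_decomposition (k := k) (fun Z ↦ H.finite_hom Z Z) X

lemma IsIndecomposableTilting.hasSummandMultiplicity {a : Λ} {M : C}
    (hM : H.IsIndecomposableTilting a M) {X : C} (hX : H.IsGood X) (hX' : H.IsCogood X) :
    HasSummandMultiplicity X M
      (Module.finrank k ((X ⟶ H.nabla a) ⧸ pairingKernel k (H.Δ a) (H.nabla a) X)) := by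
  classical
  refine ⟨H.exists_decomposition X, fun r Y hY ⟨e⟩ ↦ ?_⟩
  have hfin (Y : C) : Module.Finite k (Y ⟶ H.nabla a) := H.finite_hom _ _
  have hr (j) : (biproduct.ι Y j ≫ e.inv) ≫ (e.hom ≫ biproduct.π Y j) = 𝟙 _ := by simp
  rw [(pairingQuotientEquiv (H.Δ a) (H.nabla a) Y e).finrank_eq, Module.finrank_pi_fintype,
    Finset.sum_congr rfl fun j _ ↦ hM.finrank_pairing (hX.of_retract _ _ (hr j))
      (hX'.of_retract _ _ (hr j)) (hY j), Finset.sum_boole, Nat.card_eq_fintype_card,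
    Fintype.card_subtype, Nat.cast_id]

lemma exists_subquotient {X : C} {l : List Λ} (hl : HasFiltration H.L X l) {a : Λ} (ha : a ∈ l) :
    ∃ (A : C) (m : A ⟶ X) (q : A ⟶ H.L a), Mono m ∧ Epi q := by
  induction hl with
  | zero hM => simp at ha
  | @step E hE l h b e ih =>
    have := hE.mono_f
    have := hE.epi_g
    rcases List.mem_cons.1 ha with rfl | ha
    · exact ⟨_, 𝟙 _, E.g ≫ e.hom, inferInstance, inferInstance⟩
    · obtain ⟨A, m, q, hm, hq⟩ := ih ha
      exact ⟨A, m ≫ E.f, q, inferInstance, hq⟩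

variable (H) in
-- Take a maximal composition weight `a`, occurring as a quotient `L a` of a subobject `A`. By
-- maximality Ext¹ vanishes against `Δ a` and `nabla a`, so `π a` lifts to `A` and the map from `A`
-- to `nabla a` extends to `X`; the composite is `can a`.
lemma exists_pairing_ne_zero {X : C} (hX : ¬ IsZero X) :
    ∃ (a : Λ) (g : H.Δ a ⟶ X) (h : X ⟶ H.nabla a), g ≫ h ≠ 0 := by
  obtain ⟨l, hl⟩ := H.finiteLength X
  obtain ⟨a, ha⟩ : ∃ a, Maximal (fun b ↦ b ∈ l) a := by
    refine Set.Finite.exists_maximal (s := {b | b ∈ l}) (List.finite_toSet l) ?_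
    cases hl with
    | zero hM => exact (hX hM).elim
    | step => exact ⟨_, List.mem_cons_self⟩
  have hS : H.factorsIn {c | ¬ a < c} X := hl.prop _ fun c hc ↦ H.factorsIn_L
    (fun hac ↦ hac.not_ge (ha.2 hc hac.le))
  obtain ⟨A, m, q, hm, hq⟩ := exists_subquotient hl ha.1
  obtain ⟨h, hh⟩ := exists_extension (shortExact_cokernel m) (H.ext_nabla_right (fun _ hc ↦ hc)
    ((H.factorsIn _).prop_of_epi (cokernel.π m) hS)) (q ≫ H.incl a)
  obtain ⟨g, hg⟩ := HighestWeight.exists_lift (shortExact_kernel q) (H.ext_Δ_left (fun _ hc ↦ hc)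
    ((H.factorsIn _).prop_of_mono (kernel.ι q ≫ m) hS)) (H.π a)
  refine ⟨a, g ≫ m, h, ?_⟩
  dsimp at hh hg
  rw [Category.assoc, hh, ← Category.assoc, hg]
  exact H.can_ne_zero a

/-- Every object without extensions in both directions is a direct summand of a finite direct sum
of indecomposable tilting objects. -/
lemma exists_sum_eq_id {T : Λ → C} (hT : ∀ a, H.IsIndecomposableTilting a (T a)) {S : Set Λ} {X : C}
    (hX : H.IsGood X) (hX' : H.IsCogood X) (hS : H.factorsIn S X) :
    ∃ (r : ℕ) (c : Fin r → S) (f : ∀ j, X ⟶ T (c j)) (g : ∀ j, T (c j) ⟶ X),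
      ∑ j, f j ≫ g j = 𝟙 X := by
  obtain ⟨r, Y, hY, ⟨e⟩⟩ := H.exists_decomposition X
  have hr (j) : (biproduct.ι Y j ≫ e.inv) ≫ (e.hom ≫ biproduct.π Y j) = 𝟙 _ := by simp
  have key (j : Fin r) : ∃ c : S, Nonempty (Y j ≅ T c) := by
    obtain ⟨a, g, h, hgh⟩ := H.exists_pairing_ne_zero (hY j).1
    have : Mono (biproduct.ι Y j ≫ e.inv) := mono_of_mono_fac (hr j)
    refine ⟨⟨a, H.mem_of_hom_Δ ((H.factorsIn S).prop_of_mono (biproduct.ι Y j ≫ e.inv) hS) g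
      fun h0 ↦ hgh (by rw [h0, zero_comp])⟩, ?_⟩
    obtain ⟨s, r, hsr⟩ := (hT a).exists_retract (hX.of_retract _ _ (hr j))
      (hX'.of_retract _ _ (hr j)) g h hgh
    exact ⟨⟨r, s, isIso_of_indecomposable (hY j) (hT a).indecomposable.1 s r hsr, hsr⟩⟩
  choose c e' using key
  refine ⟨r, c, fun j ↦ e.hom ≫ biproduct.π Y j ≫ (e' j).some.hom,
    fun j ↦ (e' j).some.inv ≫ biproduct.ι Y j ≫ e.inv, ?_⟩
  have h := congrArg (fun x ↦ e.hom ≫ x ≫ e.inv) (biproduct.total (f := Y))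
  simp only [Preadditive.sum_comp, Preadditive.comp_sum, Category.assoc, Category.id_comp,
    Iso.hom_inv_id] at h
  simpa using h

end HighestWeightCategory
end HighestWeight
end

noncomputable section
namespace HighestWeight

/-! ### Cycles and boundaries -/

section Cycles

variable {D : Type u} [Category.{v} D] [Abelian D] (K : CochainComplex D ℤ)

/-- The boundaries of a cochain complex. -/
abbrev boundaries (n : ℤ) : D := kernel (K.homologyπ n)

/-- The morphism to the boundaries induced by the differential. -/
def toBoundaries (i j : ℤ) : K.X i ⟶ boundaries K j :=
  kernel.lift _ (K.toCycles i j) (by simp)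

lemma toBoundaries_ι (i j : ℤ) : toBoundaries K i j ≫ kernel.ι (K.homologyπ j) = K.toCycles i j :=
  kernel.lift_ι _ _ _

lemma epi_toBoundaries {i j : ℤ} (hij : i + 1 = j) : Epi (toBoundaries K i j) := by
  have hE : (ShortComplex.mk (K.toCycles i j) (K.homologyπ j) (by simp)).Exact :=
    ShortComplex.exact_of_g_is_cokernel _
      (K.homologyIsCokernel i j (by simp [← hij]))
  exact hE.epi_kernelLift

lemma iCycles_toCycles (i j : ℤ) : K.iCycles i ≫ K.toCycles i j = 0 := by
  rw [← cancel_mono (K.iCycles j)]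
  simp

lemma iCycles_toBoundaries (i j : ℤ) : K.iCycles i ≫ toBoundaries K i j = 0 := by
  rw [← cancel_mono (kernel.ι (K.homologyπ j)), Category.assoc, toBoundaries_ι, iCycles_toCycles,
    zero_comp]

lemma shortExact_cycles_boundaries {i j : ℤ} (hij : i + 1 = j) :
    (ShortComplex.mk (K.iCycles i) (toBoundaries K i j)
      (iCycles_toBoundaries K i j)).ShortExact :=
    by
  have := epi_toBoundaries K hij
  refine { exact := ?_ }
  let E := ShortComplex.mk (K.iCycles i) (K.d i j) (by simp)
  have hE : E.Exact :=
    ShortComplex.exact_of_f_is_kernel _ (K.cyclesIsKernel i j (by simp [← hij]))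
  let φ : ShortComplex.mk (K.iCycles i) (toBoundaries K i j) (iCycles_toBoundaries K i j) ⟶ E :=
    { τ₁ := 𝟙 _
      τ₂ := 𝟙 _
      τ₃ := kernel.ι (K.homologyπ j) ≫ K.iCycles j
      comm₂₃ := by
        dsimp [E]
        rw [← Category.assoc, toBoundaries_ι, K.toCycles_i, Category.id_comp] }
  have : Epi φ.τ₁ := inferInstanceAs (Epi (𝟙 _))
  have : IsIso φ.τ₂ := inferInstanceAs (IsIso (𝟙 _))
  have : Mono φ.τ₃ := inferInstanceAs (Mono (kernel.ι (K.homologyπ j) ≫ K.iCycles j))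
  exact (ShortComplex.exact_iff_of_epi_of_isIso_of_mono φ).2 hE

lemma shortExact_cycles {i j : ℤ} (hij : i + 1 = j) (hj : IsZero (K.homology j)) :
    (ShortComplex.mk (K.iCycles i) (K.toCycles i j) (iCycles_toCycles K i j)).ShortExact := by
  have : IsIso (kernel.ι (K.homologyπ j)) := by
    have : Epi (kernel.ι (K.homologyπ j)) :=
      (shortExact_kernel (K.homologyπ j)).exact.epi_f (hj.eq_of_tgt _ _)
    exact isIso_of_mono_of_epi _
  let E := ShortComplex.mk (K.iCycles i) (toBoundaries K i j) (iCycles_toBoundaries K i j)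
  let E' := ShortComplex.mk (K.iCycles i) (K.toCycles i j) (iCycles_toCycles K i j)
  let e : E ≅ E' := ShortComplex.isoMk (Iso.refl _) (Iso.refl _) (asIso (kernel.ι (K.homologyπ j)))
    (by simp [E, E']) (by simp [E, E', toBoundaries_ι])
  exact ShortComplex.shortExact_of_iso e (shortExact_cycles_boundaries K hij)

lemma isZero_boundaries {i j : ℤ} (hij : i + 1 = j) (hi : IsZero (K.X i)) :
    IsZero (boundaries K j) :=
  have := epi_toBoundaries K hij
  IsZero.of_epi (toBoundaries K i j) hi

lemma isIso_homologyπ {i j : ℤ} (hij : i + 1 = j) (hi : IsZero (K.X i)) :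
    IsIso (K.homologyπ j) := by
  have : Mono (K.homologyπ j) := Preadditive.mono_of_kernel_zero
    ((isZero_boundaries K hij hi).eq_of_src _ _)
  exact isIso_of_mono_of_epi _

end Cycles

namespace HighestWeightCategory

variable {k : Type v} [Field k] {Λ : Type w} [PartialOrder Λ]
  {C : Type u} [Category.{v} C] [Abelian C] [Linear k C]
  {H : HighestWeightCategory k Λ C}

/-! ### Minimal tilting complexes of standard objects -/

/-- Descending induction from the upper bound: kernels of epimorphisms between good objects are
good. -/
lemma isGood_cycles_and_boundaries {K : CochainComplex C ℤ} {b : ℤ}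
    (hb : ∀ i, b < i → IsZero (K.X i)) (hX : ∀ i, H.IsGood (K.X i))
    (hH : ∀ i, H.IsGood (K.homology i)) (i : ℤ) :
    H.IsGood (K.cycles i) ∧ H.IsGood (boundaries K i) := by
  suffices ∀ i, H.IsGood (K.cycles i) from
    ⟨this i, (this i).X₁ (shortExact_kernel (K.homologyπ i)) (hH i)⟩
  intro i
  by_cases hi : b < i
  · exact .of_isZero (IsZero.of_mono (K.iCycles i) (hb i hi))
  · obtain ⟨n, hn⟩ : ∃ n : ℕ, i + n = b + 1 := ⟨(b + 1 - i).toNat, by lia⟩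
    clear hi
    induction n generalizing i with
    | zero =>
      exact .of_isZero (IsZero.of_mono (K.iCycles i) (hb i (by simp at hn; lia)))
    | succ n ih =>
      refine IsGood.X₁ (shortExact_cycles_boundaries K rfl) (hX i) ?_
      exact (ih (i + 1) (by push_cast at hn; lia)).X₁ (shortExact_kernel (K.homologyπ (i + 1)))
        (hH _)

/-- The complex of objects of `C` underlying a complex of tilting objects. -/
abbrev underlying (K : CochainComplex H.Tilt ℤ) : CochainComplex C ℤ :=
  (H.isTilting.ι.mapHomologicalComplex (ComplexShape.up ℤ)).obj K

lemma isZero_iff_isZero_obj {X : H.Tilt} : IsZero X ↔ IsZero X.obj := by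
  rw [IsZero.iff_id_eq_zero, IsZero.iff_id_eq_zero]
  exact ⟨fun h ↦ congrArg (fun x ↦ x.hom) h, fun h ↦ ObjectProperty.hom_ext _ h⟩

lemma isZero_of_inRadical {X Y : H.Tilt} {d : X ⟶ Y} (hd : InRadical d)
    (r : Y.obj ⟶ X.obj) (hr : d.hom ≫ r = 𝟙 X.obj) : IsZero X := by
  refine isZero_of_isUnit_mem_jacobson (hd X (𝟙 X) (H.isTilting.homMk r)) ?_
  have : d ≫ H.isTilting.homMk r = 𝟙 X := ObjectProperty.hom_ext _ hr
  rw [Category.id_comp, this]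
  exact isUnit_one

lemma inRadical_d {K : CochainComplex H.Tilt ℤ} (hK : IsMinimalComplex K) {i j : ℤ}
    (hij : i + 1 = j) : InRadical (K.d i j) := by
  subst hij
  exact hK i

lemma isGood_X (K : CochainComplex H.Tilt ℤ) (i : ℤ) : H.IsGood ((underlying K).X i) :=
  isGood_of_isTilting (K.X i).property

/-- Ascending induction from the lower bound. If the preceding term vanishes and there is no
cohomology in degree `i`, the differential out of degree `i` is a monomorphism with good cokernel
pieces, so it splits; a split monomorphism in the radical has zero source. -/
lemma isZero_X_of_neg {K : CochainComplex H.Tilt ℤ} (hb : IsBoundedComplex K)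
    (hm : IsMinimalComplex K) (hH : ∀ i, H.IsGood ((underlying K).homology i))
    (hH' : ∀ i < 0, IsZero ((underlying K).homology i)) (i : ℤ) (hi : i < 0) :
    IsZero (K.X i) := by
  obtain ⟨a, b, hab⟩ := hb
  have hgood := isGood_cycles_and_boundaries (b := b)
    (fun i hi ↦ isZero_iff_isZero_obj.1 (hab i (Or.inr hi))) (isGood_X K) hH
  by_cases ha : i < a
  · exact hab i (Or.inl ha)
  obtain ⟨n, hn⟩ : ∃ n : ℕ, i = a - 1 + n := ⟨(i - a + 1).toNat, by lia⟩
  clear ha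
  induction n generalizing i with
  | zero => exact hab i (Or.inl (by simp at hn; lia))
  | succ n ih =>
    have hprev : IsZero ((underlying K).X (i - 1)) :=
      isZero_iff_isZero_obj.1 (ih (i - 1) (by lia) (by push_cast at hn; lia))
    have := isIso_homologyπ (underlying K) (sub_add_cancel i 1) hprev
    have hZ : IsZero ((underlying K).cycles i) :=
      (hH' i hi).of_iso (asIso ((underlying K).homologyπ i))
    have hE := shortExact_cycles_boundaries (underlying K) (i := i) rfl
    have : Epi (toBoundaries (underlying K) i (i + 1)) := hE.epi_g
    have : Mono (toBoundaries (underlying K) i (i + 1)) := hE.exact.mono_g (hZ.eq_of_src _ _)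
    have : IsIso (toBoundaries (underlying K) i (i + 1)) := isIso_of_mono_of_epi _
    have hco : H.IsCogood ((underlying K).X i) := isCogood_of_isTilting (K.X i).property
    -- The retraction is extended step by step from the boundaries to the cycles and then to the
    -- whole term in degree `i + 1`; the successive quotients, cohomology and the next boundaries,
    -- are good.
    obtain ⟨r₀, hr₀⟩ : ∃ r₀, toBoundaries (underlying K) i (i + 1) ≫ r₀ = 𝟙 _ :=
      ⟨inv (toBoundaries (underlying K) i (i + 1)), IsIso.hom_inv_id _⟩
    obtain ⟨r₁, hr₁⟩ := exists_extension (shortExact_kernel ((underlying K).homologyπ (i + 1)))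
      ((hH _).ext_one hco) r₀
    obtain ⟨r₂, hr₂⟩ := exists_extension (shortExact_cycles_boundaries (underlying K)
      (i := i + 1) rfl) ((hgood _).2.ext_one hco) r₁
    refine isZero_of_inRadical (hm i) r₂ ?_
    change (underlying K).d i (i + 1) ≫ r₂ = 𝟙 _
    dsimp at hr₁ hr₂
    rw [← (underlying K).toCycles_i, Category.assoc, hr₂, ← toBoundaries_ι, Category.assoc, hr₁,
      hr₀]

/-- A minimal coresolution of an object of `C` by tilting objects. -/
structure TiltingCoresolution (H : HighestWeightCategory k Λ C) (M : C) where
  /-- the terms -/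
  X : ℕ → C
  tilting : ∀ n, H.isTilting (X n)
  bounded : ∃ b, ∀ n, b < n → IsZero (X n)
  /-- the cocycles -/
  Z : ℕ → C
  f : ∀ n, Z n ⟶ X n
  g : ∀ n, X n ⟶ Z (n + 1)
  w : ∀ n, f n ≫ g n = 0
  shortExact : ∀ n, (ShortComplex.mk (f n) (g n) (w n)).ShortExact
  good : ∀ n, H.IsGood (Z n)
  /-- the augmentation -/
  iso : Z 0 ≅ M
  radical : ∀ n, InRadical (H.isTilting.homMk (g n ≫ f (n + 1)) :
    (⟨X n, tilting n⟩ : H.Tilt) ⟶ ⟨X (n + 1), tilting (n + 1)⟩)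

lemma IsMinimalTiltingComplex.exists_coresolution {a : Λ} {K : CochainComplex H.Tilt ℤ}
    (hK : H.IsMinimalTiltingComplex ((CochainComplex.singleFunctor C 0).obj (H.Δ a)) K) :
    (∀ i < 0, IsZero (K.X i)) ∧
      ∃ R : H.TiltingCoresolution (H.Δ a), ∀ n : ℕ, R.X n = (K.X n).obj := by
  let := HasDerivedCategory.standard C
  obtain ⟨e⟩ := hK.iso
  have eH (i : ℤ) : (underlying K).homology i ≅
      ((HomologicalComplex.single C (ComplexShape.up ℤ) 0).obj (H.Δ a)).homology i :=
    ((DerivedCategory.homologyFunctorFactors C i).app _).symm ≪≫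
      (DerivedCategory.homologyFunctor C i).mapIso e ≪≫
        (DerivedCategory.homologyFunctorFactors C i).app _
  have hH0 : (underlying K).homology 0 ≅ H.Δ a :=
    eH 0 ≪≫ HomologicalComplex.singleObjHomologySelfIso _ _ _
  have hHz (i : ℤ) (hi : i ≠ 0) : IsZero ((underlying K).homology i) :=
    (HomologicalComplex.isZero_single_obj_homology _ _ _ _ hi).of_iso (eH i)
  have hH (i : ℤ) : H.IsGood ((underlying K).homology i) := by
    by_cases hi : i = 0
    · subst hi
      exact (isGood_Δ a).of_iso hH0.symm
    · exact .of_isZero (hHz i hi)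
  have hneg := isZero_X_of_neg hK.bounded hK.minimal hH (fun i hi ↦ hHz i hi.ne)
  refine ⟨hneg, ?_⟩
  have h0 := isIso_homologyπ (underlying K) (i := -1) (j := 0) rfl
    (isZero_iff_isZero_obj.1 (hneg (-1) (by simp)))
  obtain ⟨_, b, hab⟩ := hK.bounded
  have hgood := isGood_cycles_and_boundaries (b := b)
    (fun i hi ↦ isZero_iff_isZero_obj.1 (hab i (Or.inr hi))) (isGood_X K) hH
  exact ⟨{
    X n := (K.X n).obj
    tilting n := (K.X n).property
    bounded := ⟨b.toNat, fun n hn ↦ isZero_iff_isZero_obj.1 (hab n (Or.inr (by lia)))⟩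
    Z n := (underlying K).cycles n
    f n := (underlying K).iCycles n
    g n := (underlying K).toCycles n (n + 1 : ℕ)
    w n := iCycles_toCycles (underlying K) _ _
    shortExact n := shortExact_cycles (underlying K) (by simp) (hHz _ (by lia))
    good n := (hgood n).1
    iso := asIso ((underlying K).homologyπ 0) ≪≫ hH0
    radical n := by
      have := inRadical_d hK.minimal (i := n) (j := (n + 1 : ℕ)) (by simp)
      have h : K.d n (n + 1 : ℕ) = H.isTilting.homMk
          ((underlying K).toCycles n (n + 1 : ℕ) ≫ (underlying K).iCycles (n + 1 : ℕ)) :=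
        ObjectProperty.hom_ext _ ((underlying K).toCycles_i _ _).symm
      rw [h] at this
      exact this }, fun n ↦ rfl⟩

lemma TiltingCoresolution.comp_Δ_eq_zero {M : C} (R : H.TiltingCoresolution M) {T : Λ → C}
    (hT : ∀ a, H.IsIndecomposableTilting a (T a)) (n : ℕ) {a : Λ} (φ : H.Δ a ⟶ R.X n)
    (ψ : R.X (n + 1) ⟶ H.nabla a) : φ ≫ (R.g n ≫ R.f (n + 1)) ≫ ψ = 0 :=
  (hT a).comp_radical_comp (R.radical n) φ ψ

/-- Otherwise let `b` be maximal among the standard weights of all terms that are not ≤ `a`; it is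
then maximal among all weights. Minimality shows that maps from `Δ b` to the terms die under the
differential, and inductively `Δ b` has no nonzero maps to the cocycles, hence none to the terms.
But `Δ b` embeds into one of them. -/
lemma TiltingCoresolution.factorsIn {a : Λ} (R : H.TiltingCoresolution (H.Δ a)) {T : Λ → C}
    (hT : ∀ a, H.IsIndecomposableTilting a (T a)) (n : ℕ) :
    H.factorsIn (Set.Iic a) (R.X n) := by
  by_contra hcon
  choose l hl using fun n ↦ (R.tilting n).1
  obtain ⟨N, hN⟩ := R.bounded
  have hfin : {c | ∃ n, c ∈ l n}.Finite := by
    refine ((Set.finite_Iic N).biUnion fun n _ ↦ List.finite_toSet (l n)).subset ?_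
    rintro c ⟨n, hn⟩
    refine Set.mem_biUnion (x := n) ?_ hn
    by_contra hNn
    exact mem_of_Δ_filtration (S := ∅) (hl n)
      ((H.factorsIn ∅).prop_of_isZero (hN n (not_le.1 hNn))) c hn
  obtain ⟨b, ⟨⟨m, hbm⟩, hba⟩, hmax⟩ :
      ∃ b, Maximal (fun c ↦ (∃ n, c ∈ l n) ∧ ¬ c ≤ a) b := by
    refine Set.Finite.exists_maximal (s := {c | (∃ n, c ∈ l n) ∧ ¬ c ≤ a})
      (hfin.subset fun c hc ↦ hc.1) ?_
    by_contra hne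
    refine hcon ((hl n).prop _ fun c hc ↦ H.factorsIn_mono (Set.Iic_subset_Iic.2 ?_)
      (H.factorsIn_Δ c))
    by_contra hca
    exact hne ⟨c, ⟨n, hc⟩, hca⟩
  have hmax' (n : ℕ) (c : Λ) (hc : c ∈ l n) : ¬ b < c := fun hbc ↦
    hbc.not_ge (hmax ⟨⟨n, hc⟩, fun hca ↦ hba (hbc.le.trans hca)⟩ hbc.le)
  have hS (n : ℕ) : H.factorsIn {c | ¬ b < c} (R.X n) := (hl n).prop _ fun c hc ↦
    H.factorsIn_mono (fun d (hd : d ≤ c) (hbd : b < d) ↦ hmax' n c hc (hbd.trans_le hd))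
      (H.factorsIn_Δ c)
  have hmono (n : ℕ) : Mono (R.f n) := (R.shortExact n).mono_f
  -- A nonzero image in the next term has quotient `L b`. Its map to `nabla b` extends to that term
  -- by maximality of `b`, which contradicts that the differential pairs to zero.
  have hd (n : ℕ) (φ : H.Δ b ⟶ R.X n) : φ ≫ R.g n = 0 := by
    by_contra h0
    have h1 : φ ≫ R.g n ≫ R.f (n + 1) ≠ 0 := fun h ↦ h0 (by
      rwa [← cancel_mono (R.f (n + 1)), zero_comp, Category.assoc])
    obtain ⟨q, hq, -⟩ := H.exists_image_to_L _ h1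
    obtain ⟨ψ, hψ⟩ := exists_extension (shortExact_cokernel (image.ι (φ ≫ R.g n ≫ R.f (n + 1))))
      (H.ext_nabla_right (fun _ hc ↦ hc)
        ((H.factorsIn _).prop_of_epi (cokernel.π _) (hS (n + 1)))) (q ≫ H.incl b)
    dsimp at hψ
    refine H.can_ne_zero b ?_
    rw [can, ← hq, Category.assoc, ← hψ, image.fac_assoc]
    simpa using R.comp_Δ_eq_zero hT n φ ψ
  -- In degree 0 the cocycles are `Δ a`, all of whose weights are ≤ `a`; in higher degrees a map to
  -- the cocycles lifts to the preceding term.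
  have hZ (n : ℕ) (φ : H.Δ b ⟶ R.Z n) : φ = 0 := by
    cases n with
    | zero =>
      rw [← cancel_mono R.iso.hom, zero_comp]
      by_contra h
      exact hba (Set.mem_Iic.1 (H.mem_of_hom_Δ (H.factorsIn_Δ a) _ h))
    | succ n =>
      obtain ⟨ψ, rfl⟩ := exists_lift (R.shortExact n) (H.ext_Δ_left (fun _ hc ↦ hc)
        ((H.factorsIn _).prop_of_mono (R.f n) (hS n))) φ
      exact hd n ψ
  obtain ⟨i, hi, -⟩ := exists_Δ_mono (hl m) hbm (hmax' m)
  have hi0 : i = 0 := by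
    rw [← (R.shortExact m).exact.lift_f i (hd m i)]
    simp only [hZ m ((R.shortExact m).exact.lift i (hd m i)), zero_comp]
  exact H.can_ne_zero b ((IsZero.of_mono_eq_zero i hi0).eq_of_src _ _)

end HighestWeightCategory
end HighestWeight
end

noncomputable section
namespace HighestWeight

/-! ### Extensions into an object with a minimal injective resolution -/

section Resolution

open Abelian

variable {D : Type u} [Category.{v} D] [Abelian D] {k : Type*} [Field k] [Linear k D]

/-- Dimension shifting along the `Z n`. The hypothesis `hg` says that Hom(L, -) kills the
differentials, so nothing is lost in passing to cohomology. -/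
lemma nonempty_ext_linearEquiv (L : D) (n : ℕ) (Z I : ℕ → D) (f : ∀ n, Z n ⟶ I n)
    (g : ∀ n, I n ⟶ Z (n + 1)) (w : ∀ n, f n ≫ g n = 0)
    (hE : ∀ n, (ShortComplex.mk (f n) (g n) (w n)).ShortExact) (hI : ∀ n, Injective (I n))
    (hg : ∀ n (φ : L ⟶ I n), φ ≫ g n = 0) :
    Nonempty (ExtGroup L (Z 0) n ≃ₗ[k] (L ⟶ I n)) := by
  let := HasExt.standard D
  induction n generalizing Z I with
  | zero =>
    have := (hE 0).mono_f
    refine ⟨Ext.linearEquiv₀.trans (LinearEquiv.ofBijective (Linear.rightComp k L (f 0))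
      ⟨fun φ ψ h ↦ (cancel_mono (f 0)).1 h, fun φ ↦ ?_⟩)⟩
    exact ⟨(hE 0).exact.lift φ (hg 0 φ), (hE 0).exact.lift_f φ (hg 0 φ)⟩
  | succ n ih =>
    obtain ⟨e⟩ := ih (fun n ↦ Z (n + 1)) (fun n ↦ I (n + 1)) (fun n ↦ f (n + 1))
      (fun n ↦ g (n + 1)) (fun n ↦ w (n + 1)) (fun n ↦ hE (n + 1)) (fun n ↦ hI (n + 1))
      (fun n ↦ hg (n + 1))
    let δ : Ext L (Z 1) n →ₗ[k] Ext L (Z 0) (n + 1) :=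
      (hE 0).extClass.postcompOfLinear k L rfl
    have hδ (x) : δ x = x.comp (hE 0).extClass rfl := rfl
    refine ⟨(LinearEquiv.ofBijective δ ⟨?_, fun x ↦ ?_⟩).symm.trans e⟩
    · rw [injective_iff_map_eq_zero]
      intro x hx
      obtain ⟨y, rfl⟩ := Ext.covariant_sequence_exact₃ L (hE 0) x rfl hx
      -- The kernel of the connecting map comes from Ext^n(L, I 0): for `n = 0` it is killed by
      -- `hg`, for `n > 0` this group vanishes.
      cases n with
      | zero =>
        obtain ⟨φ, rfl⟩ := (Ext.mk₀_bijective _ _).surjective y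
        have := hg 0 φ
        dsimp
        rw [Ext.mk₀_comp_mk₀, this, Ext.mk₀_zero]
      | succ n =>
        have := hI 0
        rw [show y = 0 from Ext.eq_zero_of_injective y, Ext.zero_comp]
    · have := hI 0
      have h0 : x.comp (Ext.mk₀ (f 0)) (add_zero _) = 0 := Ext.eq_zero_of_injective _
      obtain ⟨y, hy⟩ := Ext.covariant_sequence_exact₁ L (hE 0) x h0 rfl
      exact ⟨y, hy⟩

/-- The functoriality of `Ext` with respect to isomorphisms in the second variable. -/
def extLinearEquivOfIso (L : D) (n : ℕ) {Y Y' : D} (e : Y ≅ Y') :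
    ExtGroup L Y n ≃ₗ[k] ExtGroup L Y' n :=
  letI := HasExt.standard D
  LinearEquiv.ofLinearMap ((Ext.mk₀ e.hom).postcompOfLinear k L (add_zero n))
    ((Ext.mk₀ e.inv).postcompOfLinear k L (add_zero n))
    (by
      ext x
      change (x.comp (Ext.mk₀ e.inv) (add_zero n)).comp (Ext.mk₀ e.hom) (add_zero n) = x
      rw [Ext.comp_assoc _ _ _ (add_zero n) (zero_add 0) (by simp), Ext.mk₀_comp_mk₀,
        e.inv_hom_id, Ext.comp_mk₀_id])
    (by
      ext x
      change (x.comp (Ext.mk₀ e.hom) (add_zero n)).comp (Ext.mk₀ e.inv) (add_zero n) = x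
      rw [Ext.comp_assoc _ _ _ (add_zero n) (zero_add 0) (by simp), Ext.mk₀_comp_mk₀,
        e.hom_inv_id, Ext.comp_mk₀_id])

end Resolution

/-! ### Exactness in a Serre subcategory -/

section FullSubcategory

lemma shortExact_of_map_ι {D : Type u} [Category.{v} D] [Abelian D] {P : ObjectProperty D}
    [P.IsSerreClass] (E : ShortComplex P.FullSubcategory) (hE : (E.map P.ι).ShortExact) :
    E.ShortExact where
  mono_f := P.ι.mono_of_mono_map hE.mono_f
  epi_g := P.ι.epi_of_epi_map hE.epi_g
  exact := by
    have := hE.mono_f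
    have : Mono E.f := P.ι.mono_of_mono_map hE.mono_f
    refine ShortComplex.exact_of_f_is_kernel _ (KernelFork.IsLimit.ofι' E.f E.zero
      fun φ hφ ↦ ⟨P.homMk (hE.exact.lift φ.hom (congrArg (fun x ↦ x.hom) hφ)), ?_⟩)
    exact ObjectProperty.hom_ext _ (hE.exact.lift_f _ _)

end FullSubcategory

/-! ### Modules over the endomorphism algebra -/

section RingelDual

open ModuleCat

variable {k : Type v} [Field k] {D : Type u} [Category.{v} D] [Preadditive D] [Linear k D]
  {T : D}

/-- An endomorphism of `T` as an element of the opposite of the endomorphism algebra. -/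
def act (f : T ⟶ T) : (End T)ᵐᵒᵖ := MulOpposite.op f

lemma act_mul_act {D : Type*} [Category D] {T : D} (f g : T ⟶ T) :
    act f * act g = act (f ≫ g) := rfl

lemma act_add (f g : T ⟶ T) : act (f + g) = act f + act g := rfl

lemma act_smul (c : k) (f : T ⟶ T) : act (c • f) = c • act f := rfl

variable [∀ X Y : D, Module.Finite k (X ⟶ Y)]

/-- The functional on `Hom(X, T)` corresponding to an element of `Hom(X, T)^*`. -/
def toFunctional {X : D} : (dualHomTo k T X).obj ≃+ Module.Dual k (X ⟶ T) :=
  AddEquiv.refl (Module.Dual k (X ⟶ T))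

lemma toFunctional_smul {X : D} (f : T ⟶ T) (φ : (dualHomTo k T X).obj) (x : X ⟶ T) :
    toFunctional (act f • φ) x = toFunctional φ (x ≫ f) :=
  rfl

lemma toFunctional_smul_field {X : D} (c : k) (φ : (dualHomTo k T X).obj) :
    toFunctional (c • φ) = c • toFunctional φ := by
  refine LinearMap.ext fun x ↦ ?_
  rw [← algebraMap_smul (End T)ᵐᵒᵖ c φ]
  change toFunctional φ (x ≫ (c • 𝟙 T)) = _
  simp

/-- A morphism to `Hom(X, T)^*`, given by functionals. -/
def homToDual {M : RingelDual k T} {X : D} (Φ : M.obj →+ Module.Dual k (X ⟶ T))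
    (hΦ : ∀ f m x, Φ (act f • m) x = Φ m (x ≫ f)) :
    M ⟶ dualHomTo k T X :=
  (finiteDimensional k (End T)ᵐᵒᵖ).homMk (ConcreteCategory.ofHom
    (C := ModuleCat (End T)ᵐᵒᵖ) (X := M.obj) (Y := (dualHomTo k T X).obj)
    ({ toFun m := toFunctional.symm (Φ m)
       map_add' m m' := by rw [map_add, map_add]
       map_smul' a m := toFunctional.injective (LinearMap.ext fun x ↦ hΦ a.unop m x) } :
      M.obj →ₗ[(End T)ᵐᵒᵖ] (dualHomTo k T X).obj))

lemma hom_dualHomTo_ext {M : RingelDual k T} {X : D} {f g : M ⟶ dualHomTo k T X}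
    (h : ∀ m x, toFunctional (f.hom.hom m) x = toFunctional (g.hom.hom m) x) : f = g :=
  ObjectProperty.hom_ext _ (ModuleCat.hom_ext (LinearMap.ext fun m ↦
    toFunctional.injective (LinearMap.ext (h m))))

/-- The functoriality of `Hom(X, T)^*` in `X`. -/
def dualHomToMap {X Y : D} (f : X ⟶ Y) : dualHomTo k T X ⟶ dualHomTo k T Y :=
  homToDual ((Linear.leftComp k T f).dualMap.toAddMonoidHom.comp toFunctional.toAddMonoidHom)
    fun u φ x ↦ congrArg (toFunctional φ) (Category.assoc f x u)

lemma toFunctional_dualHomToMap {X Y : D} (f : X ⟶ Y) (φ : (dualHomTo k T X).obj) (x : Y ⟶ T) :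
    toFunctional ((dualHomToMap f).hom.hom φ) x = toFunctional φ (f ≫ x) :=
  rfl

lemma dualHomToMap_comp {X Y Z : D} (f : X ⟶ Y) (g : Y ⟶ Z) :
    dualHomToMap (k := k) (T := T) (f ≫ g) = dualHomToMap f ≫ dualHomToMap g :=
  hom_dualHomTo_ext fun φ x ↦ congrArg (toFunctional φ) (Category.assoc f g x)

lemma dualHomToMap_id (X : D) : dualHomToMap (k := k) (T := T) (𝟙 X) = 𝟙 _ :=
  hom_dualHomTo_ext fun φ x ↦ congrArg (toFunctional φ) (Category.id_comp x)

/-- The functoriality of `Hom(X, T)^*` with respect to isomorphisms. -/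
def dualHomToIso {X Y : D} (e : X ≅ Y) : dualHomTo k T X ≅ dualHomTo k T Y where
  hom := dualHomToMap e.hom
  inv := dualHomToMap e.inv
  hom_inv_id := by rw [← dualHomToMap_comp, e.hom_inv_id, dualHomToMap_id]
  inv_hom_id := by rw [← dualHomToMap_comp, e.inv_hom_id, dualHomToMap_id]

lemma dualHomToMap_comp_eq_zero {X Y Z : D} {f : X ⟶ Y} {g : Y ⟶ Z} (w : f ≫ g = 0) :
    dualHomToMap (k := k) (T := T) f ≫ dualHomToMap g = 0 := by
  rw [← dualHomToMap_comp, w]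
  refine hom_dualHomTo_ext fun φ x ↦ ?_
  rw [toFunctional_dualHomToMap, zero_comp, map_zero]
  rfl

/-- The three hypotheses say that Hom(-, T) is exact on the sequence, and duality over a field
preserves exactness. -/
lemma shortExact_dualHomToMap {X Y Z : D} (f : X ⟶ Y) (g : Y ⟶ Z) (w : f ≫ g = 0)
    (hf : ∀ x : X ⟶ T, ∃ y : Y ⟶ T, f ≫ y = x) (hg : ∀ y : Y ⟶ T, f ≫ y = 0 → ∃ z, g ≫ z = y)
    (hg' : ∀ z : Z ⟶ T, g ≫ z = 0 → z = 0) :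
    (ShortComplex.mk (dualHomToMap (k := k) (T := T) f) (dualHomToMap g)
      (dualHomToMap_comp_eq_zero w)).ShortExact := by
  apply shortExact_of_map_ι
  have hf' : Function.Surjective (Linear.leftComp k T f) := hf
  refine { exact := ?_, mono_f := ?_, epi_g := ?_ }
  · rw [ShortComplex.moduleCat_exact_iff]
    intro (ψ : (dualHomTo k T Y).obj) (hψ : (dualHomToMap g).hom.hom ψ = 0)
    have : toFunctional ψ ∈ (LinearMap.range (Linear.leftComp k T f).dualMap) := by
      rw [LinearMap.range_dualMap_eq_dualAnnihilator_ker, Submodule.mem_dualAnnihilator]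
      intro y hy
      obtain ⟨z, rfl⟩ := hg y hy
      rw [← toFunctional_dualHomToMap, hψ, map_zero, LinearMap.zero_apply]
    exact this
  · rw [ModuleCat.mono_iff_injective]
    exact LinearMap.dualMap_injective_of_surjective hf'
  · rw [ModuleCat.epi_iff_surjective]
    refine LinearMap.dualMap_surjective_of_injective (f := Linear.leftComp k T g) ?_
    rw [injective_iff_map_eq_zero]
    exact hg'

lemma sum_toFunctional_smul {X : D} {r : ℕ} {a : Fin r → (X ⟶ T)} {b : Fin r → (T ⟶ X)}
    (hab : ∑ j, a j ≫ b j = 𝟙 X) (φ : (dualHomTo k T X).obj) (x : X ⟶ T) :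
    ∑ j, toFunctional (act (b j ≫ x) • φ) (a j) = toFunctional φ x := by
  simp only [toFunctional_smul, ← Category.assoc]
  rw [← map_sum, ← Preadditive.sum_comp, hab, Category.id_comp]

/-- `hab` makes `X` a summand of a power of `T`, so Hom(X, T)^* is a summand of a power of the dual
of the regular module. Maps into the latter are just linear functionals, which extend along any
injection. -/
lemma injective_dualHomTo {X : D} {r : ℕ} {a : Fin r → (X ⟶ T)} {b : Fin r → (T ⟶ X)}
    (hab : ∑ j, a j ≫ b j = 𝟙 X) : Injective (dualHomTo k T X) := by
  refine ⟨fun {M N} φ f _ ↦ ?_⟩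
  have := (finiteDimensional k (End T)ᵐᵒᵖ).preservesMonomorphisms_ι_of_isNormalEpiCategory
  have hf : Function.Injective (f.hom.hom.restrictScalars k) :=
    (ModuleCat.mono_iff_injective f.hom).1
      (inferInstanceAs (Mono ((finiteDimensional k (End T)ᵐᵒᵖ).ι.map f)))
  obtain ⟨ℓ, hℓ⟩ := LinearMap.exists_leftInverse_of_injective _ (LinearMap.ker_eq_bot.2 hf)
  have hℓ_apply (m : M.obj) : ℓ (f.hom.hom m) = m := LinearMap.congr_fun hℓ m
  -- The functionals attached to `φ`, extended to `N` by the linear retraction `ℓ`; `Φ` turns them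
  -- back into a module morphism.
  let χ (j : Fin r) : N.obj →ₗ[k] k :=
    { toFun n := toFunctional (φ.hom.hom (ℓ n)) (a j)
      map_add' n n' := by simp only [map_add, LinearMap.add_apply]
      map_smul' c n := by
        have : φ.hom.hom (c • ℓ n) = c • φ.hom.hom (ℓ n) :=
          (φ.hom.hom.restrictScalars k).map_smul c (ℓ n)
        rw [map_smul, this, toFunctional_smul_field]
        rfl }
  let Φ : N.obj →+ Module.Dual k (X ⟶ T) := AddMonoidHom.mk' (fun n ↦
    { toFun x := ∑ j, χ j (act (b j ≫ x) • n)
      map_add' x y := by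
        simp only [Preadditive.comp_add, act_add, add_smul, map_add, Finset.sum_add_distrib]
      map_smul' c x := by
        simp only [Linear.comp_smul, act_smul, smul_assoc, map_smul, Finset.smul_sum,
          RingHom.id_apply] }) fun n n' ↦ by
    ext x
    change ∑ j, χ j (act (b j ≫ x) • (n + n')) = ∑ j, χ j (act (b j ≫ x) • n) +
      ∑ j, χ j (act (b j ≫ x) • n')
    simp only [smul_add, map_add, Finset.sum_add_distrib]
  refine ⟨homToDual Φ fun u n x ↦ ?_, hom_dualHomTo_ext fun m x ↦ ?_⟩
  · change ∑ j, χ j (act (b j ≫ x) • act u • n) = ∑ j, χ j (act (b j ≫ x ≫ u) • n)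
    simp only [smul_smul, act_mul_act, Category.assoc]
  · refine Eq.trans ?_ (sum_toFunctional_smul hab (φ.hom.hom m) x)
    change ∑ j, toFunctional (φ.hom.hom (ℓ (act (b j ≫ x) • f.hom.hom m))) (a j) = _
    refine Finset.sum_congr rfl fun j _ ↦ ?_
    rw [← map_smul, ← map_smul, hℓ_apply]

/-- The class of a morphism in the head of `Hom(T, N)`. -/
def headMk {N : D} (h : T ⟶ N) : (head (homFrom k T N)).obj :=
  (Module.jacobson (End T)ᵐᵒᵖ (homFrom k T N).obj).mkQ h

lemma headMk_surjective {N : D} (m : (head (homFrom k T N)).obj) :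
    ∃ h : T ⟶ N, headMk (k := k) h = m :=
  Submodule.mkQ_surjective _ m

lemma headMk_eq_zero {N : D} (h : T ⟶ N) : headMk (k := k) h = 0 ↔
    (show (homFrom k T N).obj from h) ∈ Module.jacobson (End T)ᵐᵒᵖ (homFrom k T N).obj :=
  Submodule.Quotient.mk_eq_zero _

lemma act_smul_headMk {N : D} (u : T ⟶ T) (h : T ⟶ N) :
    act u • headMk (k := k) h = headMk (u ≫ h) :=
  rfl

lemma headMk_add {N : D} (h h' : T ⟶ N) :
    headMk (k := k) (h + h') = headMk h + headMk h' :=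
  rfl

lemma headMk_smul {N : D} (c : k) (h : T ⟶ N) :
    headMk (k := k) (c • h) = c • headMk h := by
  rw [← algebraMap_smul (End T)ᵐᵒᵖ c (headMk (k := k) h)]
  change _ = headMk ((c • 𝟙 T) ≫ h)
  simp

/-- The morphism `head Hom(T, N) ⟶ Hom(X, T)^*` given by a functional on the quotient of
`Hom(X, N)` by the kernel of the pairing with `Hom(P, X)`. -/
def homOfFunctional {P N X : D}
    (hN : ∀ h : T ⟶ N, headMk (k := k) h = 0 ↔ h ∈ pairingKernel k P N T)
    (θ : Module.Dual k ((X ⟶ N) ⧸ pairingKernel k P N X)) :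
    head (homFrom k T N) ⟶ dualHomTo k T X :=
  let φ : homFrom k T N ⟶ dualHomTo k T X := homToDual
    (AddMonoidHom.mk' (fun h : T ⟶ N ↦ θ ∘ₗ (pairingKernel k P N X).mkQ ∘ₗ Linear.rightComp k X h)
      fun (h h' : T ⟶ N) ↦ by
        refine LinearMap.ext fun x ↦ ?_
        change θ ((pairingKernel k P N X).mkQ (x ≫ (h + h'))) =
          θ ((pairingKernel k P N X).mkQ (x ≫ h)) + θ ((pairingKernel k P N X).mkQ (x ≫ h'))
        rw [Preadditive.comp_add, map_add, map_add])
    fun u h x ↦ congrArg (fun y ↦ θ ((pairingKernel k P N X).mkQ y))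
      (Category.assoc x u (show T ⟶ N from h)).symm
  (finiteDimensional k (End T)ᵐᵒᵖ).homMk (ConcreteCategory.ofHom
    (C := ModuleCat (End T)ᵐᵒᵖ) (X := (head (homFrom k T N)).obj) (Y := (dualHomTo k T X).obj)
    ((Module.jacobson (End T)ᵐᵒᵖ (homFrom k T N).obj).liftQ φ.hom.hom fun h hh ↦ by
      refine toFunctional.injective (LinearMap.ext fun x ↦ ?_)
      refine (congrArg θ ((Submodule.Quotient.mk_eq_zero _).2 fun g ↦ ?_)).trans θ.map_zero
      exact (Category.assoc _ _ _).symm.trans ((hN h).1 ((headMk_eq_zero _).2 hh) (g ≫ x))))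

lemma toFunctional_homOfFunctional {P N X : D}
    (hN : ∀ h : T ⟶ N, headMk (k := k) h = 0 ↔ h ∈ pairingKernel k P N T)
    (θ : Module.Dual k ((X ⟶ N) ⧸ pairingKernel k P N X)) (h : T ⟶ N) (x : X ⟶ T) :
    toFunctional ((homOfFunctional hN θ).hom.hom (headMk h)) x =
      θ ((pairingKernel k P N X).mkQ (x ≫ h)) :=
  rfl

lemma hom_head_ext {N X : D} {φ ψ : head (homFrom k T N) ⟶ dualHomTo k T X}
    (h : ∀ (h : T ⟶ N) (x : X ⟶ T), toFunctional (φ.hom.hom (headMk h)) x =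
      toFunctional (ψ.hom.hom (headMk h)) x) : φ = ψ := by
  refine hom_dualHomTo_ext fun m x ↦ ?_
  obtain ⟨m, rfl⟩ := headMk_surjective m
  exact h m x

lemma exists_homOfFunctional {P N X : D}
    (hN : ∀ h : T ⟶ N, headMk (k := k) h = 0 ↔ h ∈ pairingKernel k P N T)
    {r : ℕ} {a : Fin r → (X ⟶ T)} {b : Fin r → (T ⟶ X)} (hab : ∑ j, a j ≫ b j = 𝟙 X)
    (φ : head (homFrom k T N) ⟶ dualHomTo k T X) : ∃ θ, homOfFunctional hN θ = φ := by
  -- Forced by `hab`: any `h` is the sum of the `a j ≫ b j ≫ h`, and `φ` prescribes the value on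
  -- each term.
  let θ : Module.Dual k (X ⟶ N) :=
    { toFun h := ∑ j, toFunctional (φ.hom.hom (headMk (b j ≫ h))) (a j)
      map_add' h h' := by
        simp only [Preadditive.comp_add, headMk_add, map_add, LinearMap.add_apply,
          Finset.sum_add_distrib]
      map_smul' c h := by
        have (m : (head (homFrom k T N)).obj) : φ.hom.hom (c • m) = c • φ.hom.hom m :=
          (φ.hom.hom.restrictScalars k).map_smul c m
        simp only [Linear.comp_smul, headMk_smul, this, toFunctional_smul_field,
          LinearMap.smul_apply, Finset.smul_sum, RingHom.id_apply] }
  refine ⟨(pairingKernel k P N X).liftQ θ fun h hh ↦ ?_, hom_head_ext fun h x ↦ ?_⟩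
  · change ∑ j, toFunctional (φ.hom.hom (headMk (b j ≫ h))) (a j) = 0
    refine Finset.sum_eq_zero fun j _ ↦ ?_
    have : headMk (k := k) (b j ≫ h) = 0 := (hN _).2 fun g ↦ by
      rw [← Category.assoc]
      exact hh _
    rw [this, map_zero, map_zero, LinearMap.zero_apply]
  · rw [toFunctional_homOfFunctional, ← sum_toFunctional_smul hab]
    change ∑ j, toFunctional (φ.hom.hom (headMk (b j ≫ x ≫ h))) (a j) = _
    refine Finset.sum_congr rfl fun j _ ↦ ?_
    rw [← Category.assoc, ← act_smul_headMk, map_smul]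

lemma nonempty_hom_head_linearEquiv {P N X : D}
    (hN : ∀ h : T ⟶ N, headMk (k := k) h = 0 ↔ h ∈ pairingKernel k P N T)
    {r : ℕ} {a : Fin r → (X ⟶ T)} {b : Fin r → (T ⟶ X)} (hab : ∑ j, a j ≫ b j = 𝟙 X) :
    Nonempty (Module.Dual k ((X ⟶ N) ⧸ pairingKernel k P N X) ≃ₗ[k]
      (head (homFrom k T N) ⟶ dualHomTo k T X)) := by
  let Θ : Module.Dual k ((X ⟶ N) ⧸ pairingKernel k P N X) →ₗ[k]
      (head (homFrom k T N) ⟶ dualHomTo k T X) :=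
    { toFun := homOfFunctional hN
      map_add' θ θ' := hom_head_ext fun h x ↦ rfl
      map_smul' c θ := hom_head_ext fun h x ↦ by
        change _ = toFunctional (c • (homOfFunctional hN θ).hom.hom (headMk h)) x
        rw [toFunctional_smul_field]
        rfl }
  refine ⟨LinearEquiv.ofBijective Θ ⟨?_, exists_homOfFunctional hN hab⟩⟩
  rw [injective_iff_map_eq_zero]
  intro θ hθ
  refine LinearMap.ext fun y ↦ ?_
  obtain ⟨y, rfl⟩ := Submodule.mkQ_surjective _ y
  have hy : y = ∑ j, a j ≫ b j ≫ y := by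
    simp only [← Category.assoc]
    rw [← Preadditive.sum_comp, hab, Category.id_comp]
  rw [hy, map_sum, map_sum, LinearMap.zero_apply]
  refine Finset.sum_eq_zero fun j _ ↦ ?_
  rw [← toFunctional_homOfFunctional hN θ (b j ≫ y) (a j)]
  change toFunctional ((Θ θ).hom.hom _) _ = 0
  rw [hθ]
  rfl

/-- Translates minimality to the dual side: every map from the head is given by a functional
vanishing on the kernel of the pairing, which contains all `d ≫ h`. -/
lemma hom_head_comp_dualHomToMap {P N X Y : D}
    (hN : ∀ h : T ⟶ N, headMk (k := k) h = 0 ↔ h ∈ pairingKernel k P N T)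
    {r : ℕ} {a : Fin r → (X ⟶ T)} {b : Fin r → (T ⟶ X)} (hab : ∑ j, a j ≫ b j = 𝟙 X)
    (d : X ⟶ Y) (hd : ∀ (g : P ⟶ X) (h : Y ⟶ N), g ≫ d ≫ h = 0)
    (φ : head (homFrom k T N) ⟶ dualHomTo k T X) : φ ≫ dualHomToMap d = 0 := by
  obtain ⟨θ, rfl⟩ := exists_homOfFunctional hN hab φ
  refine hom_head_ext fun h x ↦ ?_
  change θ ((pairingKernel k P N X).mkQ ((d ≫ x) ≫ h)) = 0
  rw [Submodule.mkQ_apply, (Submodule.Quotient.mk_eq_zero _).2 fun g ↦ by rw [Category.assoc, hd],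
    map_zero]

end RingelDual

/-- Every element outside `N` generates `M`, so `N` contains all proper submodules and is the unique
maximal one. -/
lemma jacobson_eq_of_forall_span {A M : Type*} [Ring A] [AddCommGroup M] [Module A M]
    (N : Submodule A M) (hN : N ≠ ⊤) (h : ∀ m ∉ N, ∀ m', ∃ a : A, a • m = m') :
    Module.jacobson A M = N := by
  have key (N' : Submodule A M) (hN' : ¬ N' ≤ N) : N' = ⊤ := by
    obtain ⟨m, hm, hmN⟩ := SetLike.not_le_iff_exists.1 hN'
    refine eq_top_iff.2 fun m' _ ↦ ?_
    obtain ⟨a, rfl⟩ := h m hmN m'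
    exact N'.smul_mem a hm
  refine le_antisymm (sInf_le ⟨hN, fun N' hN' ↦ key N' hN'.not_ge⟩) (le_sInf fun N' hN' ↦ ?_)
  by_cases hle : N' ≤ N
  · exact (hN'.le_iff_eq hN).1 hle |>.le
  · exact (hN'.1 (key N' hle)).elim

end HighestWeight
end

noncomputable section
namespace HighestWeight

lemma sum_π_comp_ι {D : Type u} [Category.{v} D] [Preadditive D] {J : Type w} [Fintype J]
    (X : J → D) [HasBiproduct X] :
    ∑ j, biproduct.π X j ≫ biproduct.ι X j = 𝟙 (⨁ X) := by
  refine biproduct.hom_ext' _ _ fun j ↦ ?_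
  rw [Preadditive.comp_sum, Category.comp_id]
  refine (Finset.sum_eq_single j (fun a _ ha ↦ ?_) (by simp)).trans ?_
  · rw [← Category.assoc, biproduct.ι_π_ne X ha.symm, zero_comp]
  · rw [← Category.assoc, biproduct.ι_π_self, Category.id_comp]

namespace HighestWeightCategory

variable {k : Type v} [Field k] {Λ : Type w} [PartialOrder Λ]
  {C : Type u} [Category.{v} C] [Abelian C] [Linear k C]
  {H : HighestWeightCategory k Λ C} {Γ : LowerSet Λ}

/-! ### The Ringel dual of a truncation -/

section Truncation

variable [Finite Γ] {T : Λ → C} (hT : ∀ a, H.IsIndecomposableTilting a (T a))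

/-- The summands of the characteristic tilting object. -/
abbrev tiltingSummand (a : Γ) : H.Truncation Γ := ⟨T a, H.mem_truncation a.2 (hT a).mem⟩

/-- The inclusion of a summand of the characteristic tilting object. -/
def summandι (a : Γ) : tiltingSummand hT a ⟶ H.charTilting Γ hT :=
  biproduct.ι (tiltingSummand hT) a

/-- The projection to a summand of the characteristic tilting object. -/
def summandπ (a : Γ) : H.charTilting Γ hT ⟶ tiltingSummand hT a :=
  biproduct.π (tiltingSummand hT) a

lemma summandι_π (a : Γ) : summandι hT a ≫ summandπ hT a = 𝟙 _ :=
  biproduct.ι_π_self _ _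

lemma sum_summand [Fintype Γ] :
    ∑ a : Γ, (summandπ hT a).hom ≫ (summandι hT a).hom = 𝟙 (H.charTilting Γ hT).obj := by
  have h : ∑ a : Γ, summandπ hT a ≫ summandι hT a = 𝟙 (H.charTilting Γ hT) :=
    sum_π_comp_ι (tiltingSummand hT)
  have := congrArg (fun f ↦ (serreGenerated H.L (Γ : Set Λ)).ι.map f) h
  rw [Functor.map_sum] at this
  exact this

lemma isGood_charTilting : H.IsGood (H.charTilting Γ hT).obj := by
  have := Fintype.ofFinite Γ
  exact fun b ↦ ext_of_sum_left _ _ (sum_summand hT) fun a ↦ isGood_of_isTilting (hT a).tilting b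

lemma isCogood_charTilting : H.IsCogood (H.charTilting Γ hT).obj := by
  have := Fintype.ofFinite Γ
  exact fun b ↦ ext_of_sum_right _ _ (sum_summand hT) fun a ↦ isCogood_of_isTilting (hT a).tilting b

lemma headMk_eq_zero_iff (a : Γ) (h : H.charTilting Γ hT ⟶ H.truncNabla a) :
    headMk (k := k) h = 0 ↔
      h ∈ pairingKernel k (H.truncΔ a) (H.truncNabla a) (H.charTilting Γ hT) := by
  let N : Submodule (End (H.charTilting Γ hT))ᵐᵒᵖ
      (homFrom k (H.charTilting Γ hT) (H.truncNabla a)).obj :=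
    { carrier := {h | h ∈ pairingKernel k (H.truncΔ a) (H.truncNabla a) (H.charTilting Γ hT)}
      add_mem' := (pairingKernel k (H.truncΔ a) (H.truncNabla a) (H.charTilting Γ hT)).add_mem
      zero_mem' := fun _ ↦ comp_zero
      smul_mem' u h hh g := (Category.assoc g (u.unop : H.charTilting Γ hT ⟶ _) h).symm.trans
        (hh (g ≫ (u.unop : H.charTilting Γ hT ⟶ _))) }
  obtain ⟨i, p, hip⟩ := (hT a).exists_factorization
  have hgood := isGood_charTilting (Γ := Γ) hT
  have hcogood := isCogood_charTilting (Γ := Γ) hT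
  rw [headMk_eq_zero, jacobson_eq_of_forall_span N]
  · rfl
  · intro htop
    let p' : tiltingSummand hT a ⟶ H.truncNabla a := (serreGenerated H.L (Γ : Set Λ)).homMk p
    let i' : H.truncΔ a ⟶ tiltingSummand hT a := (serreGenerated H.L (Γ : Set Λ)).homMk i
    have h1 : ∀ x, x ∈ N := fun x ↦ htop ▸ Submodule.mem_top
    have h2 : (i' ≫ summandι hT a) ≫ (summandπ hT a ≫ p') = 0 :=
      h1 (show H.charTilting Γ hT ⟶ H.truncNabla a from summandπ hT a ≫ p') _
    rw [Category.assoc, ← Category.assoc (summandι hT a), summandι_π, Category.id_comp] at h2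
    exact hip.ne_zero (congrArg (fun x ↦ x.hom) h2)
  -- To reach `h'` from `h`: lift `h'` to T_a, undo the automorphism `s ≫ r`, and return to the
  -- tilting object by `s`, on which `h` restricts to `s ≫ r ≫ p`.
  · intro (h : H.charTilting Γ hT ⟶ H.truncNabla a) hh
      (h' : H.charTilting Γ hT ⟶ H.truncNabla a)
    obtain ⟨g, hg⟩ : ∃ g : H.truncΔ a ⟶ H.charTilting Γ hT, g ≫ h ≠ 0 := by
      by_contra! hcon
      exact hh hcon
    obtain ⟨s, hs⟩ := hip.exists_extend hcogood g.hom
    obtain ⟨r, hr⟩ := hip.exists_lift hgood h.hom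
    obtain ⟨r', hr'⟩ := hip.exists_lift hgood h'.hom
    have := hip.isIso (hT a).indecomposable (s ≫ r) (fun h0 ↦ hg (ObjectProperty.hom_ext _ (by
      rw [Category.assoc, ← Category.assoc i, hs, hr] at h0
      exact h0)))
    let u : H.charTilting Γ hT ⟶ H.charTilting Γ hT :=
      (serreGenerated H.L (Γ : Set Λ)).homMk (r' ≫ inv (s ≫ r) ≫ s)
    refine ⟨act u, ObjectProperty.hom_ext _ ?_⟩
    have e : (r' ≫ inv (s ≫ r) ≫ s) ≫ r ≫ p = r' ≫ p := by
      rw [Category.assoc, Category.assoc, ← Category.assoc s, IsIso.inv_hom_id_assoc]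
    exact (congrArg (fun x ↦ (r' ≫ inv (s ≫ r) ≫ s) ≫ x) hr.symm).trans (e.trans hr')

lemma exists_sum_eq_id_truncation (X : H.Truncation Γ) (hX : H.IsGood X.obj)
    (hX' : H.IsCogood X.obj) :
    ∃ (r : ℕ) (a : Fin r → (X ⟶ H.charTilting Γ hT)) (b : Fin r → (H.charTilting Γ hT ⟶ X)),
      ∑ j, a j ≫ b j = 𝟙 X := by
  obtain ⟨r, c, f, g, hfg⟩ := exists_sum_eq_id hT hX hX'
    (H.factorsIn_of_serreGenerated X.property)
  let f' (j) : X ⟶ tiltingSummand hT (c j) := (serreGenerated H.L (Γ : Set Λ)).homMk (f j)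
  let g' (j) : tiltingSummand hT (c j) ⟶ X := (serreGenerated H.L (Γ : Set Λ)).homMk (g j)
  refine ⟨r, fun j ↦ f' j ≫ summandι hT (c j), fun j ↦ summandπ hT (c j) ≫ g' j, ?_⟩
  have hj (j : Fin r) : (f' j ≫ summandι hT (c j)) ≫ summandπ hT (c j) ≫ g' j = f' j ≫ g' j := by
    rw [Category.assoc, ← Category.assoc (summandι hT (c j)), summandι_π, Category.id_comp]
  rw [Finset.sum_congr rfl fun j _ ↦ hj j]
  apply (serreGenerated H.L (Γ : Set Λ)).ι.map_injective
  rw [Functor.map_sum]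
  exact hfg

/-- The pairings in `C` and in a truncation of `C` agree. -/
def truncPairingEquiv (P N X : H.Truncation Γ) :
    ((X ⟶ N) ⧸ pairingKernel k P N X) ≃ₗ[k]
      (X.obj ⟶ N.obj) ⧸ pairingKernel k P.obj N.obj X.obj :=
  Submodule.Quotient.equiv _ _
    { toFun f := f.hom
      invFun f := (serreGenerated H.L (Γ : Set Λ)).homMk f
      map_add' _ _ := rfl
      map_smul' _ _ := rfl
      left_inv _ := rfl
      right_inv _ := rfl } (by
    apply le_antisymm
    · rintro _ ⟨h, hh, rfl⟩ g
      exact congrArg (fun x ↦ x.hom) (hh ((serreGenerated H.L (Γ : Set Λ)).homMk g))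
    · intro h hh
      exact ⟨(serreGenerated H.L (Γ : Set Λ)).homMk h,
        fun g ↦ ObjectProperty.hom_ext _ (hh g.hom), rfl⟩)

/-- Good cocycles have no first extensions by the characteristic tilting object, so the dual Hom
functor turns the coresolution into an injective resolution, on which Hom from `dualL` has zero
differentials. -/
lemma TiltingCoresolution.nonempty_ext_linearEquiv {a : Λ} (R : H.TiltingCoresolution (H.Δ a))
    (ha : a ∈ Γ) (b : Γ) (n : ℕ) :
    Nonempty (ExtGroup (H.dualL hT b) (H.dualNabla hT ⟨a, ha⟩) n ≃ₗ[k]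
      Module.Dual k ((R.X n ⟶ H.nabla b) ⧸ pairingKernel k (H.Δ b) (H.nabla b) (R.X n))) := by
  let Q := serreGenerated H.L (Γ : Set Λ)
  have hX (n : ℕ) : Q (R.X n) := H.mem_truncation ha (H.serreGenerated_iff.2 (R.factorsIn hT n))
  have hZ (n : ℕ) : Q (R.Z n) := by
    have : Mono (R.f n) := (R.shortExact n).mono_f
    exact Q.prop_of_mono (R.f n) (hX n)
  let X (n : ℕ) : H.Truncation Γ := ⟨R.X n, hX n⟩
  let Z (n : ℕ) : H.Truncation Γ := ⟨R.Z n, hZ n⟩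
  let f (n : ℕ) : Z n ⟶ X n := Q.homMk (R.f n)
  let g (n : ℕ) : X n ⟶ Z (n + 1) := Q.homMk (R.g n)
  have w (n : ℕ) : f n ≫ g n = 0 := ObjectProperty.hom_ext _ (R.w n)
  have hX' (n : ℕ) := exists_sum_eq_id_truncation hT (X n) (isGood_of_isTilting (R.tilting n))
    (isCogood_of_isTilting (R.tilting n))
  choose r s t hst using hX'
  have hE (n : ℕ) := shortExact_dualHomToMap (k := k) (T := H.charTilting Γ hT) (f n) (g n) (w n)
    (fun x ↦ by
      obtain ⟨y, hy⟩ := exists_extension (R.shortExact n)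
        ((R.good (n + 1)).ext_one (isCogood_charTilting hT)) x.hom
      exact ⟨Q.homMk y, ObjectProperty.hom_ext _ hy⟩)
    (fun y hy ↦ by
      have := (R.shortExact n).epi_g
      have hy' : R.f n ≫ y.hom = 0 := congrArg (fun x ↦ x.hom) hy
      exact ⟨Q.homMk ((R.shortExact n).exact.desc y.hom hy'),
        ObjectProperty.hom_ext _ ((R.shortExact n).exact.g_desc y.hom hy')⟩)
    (fun z hz ↦ by
      have : Epi (R.g n) := (R.shortExact n).epi_g
      have hz' : R.g n ≫ z.hom = 0 := congrArg (fun x ↦ x.hom) hz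
      exact ObjectProperty.hom_ext _ ((cancel_epi (R.g n)).1 (hz'.trans comp_zero.symm)))
  have hN := headMk_eq_zero_iff hT b
  obtain ⟨e⟩ := HighestWeight.nonempty_ext_linearEquiv (k := k) (H.dualL hT b) n
    (fun n ↦ dualHomTo k (H.charTilting Γ hT) (Z n))
    (fun n ↦ dualHomTo k (H.charTilting Γ hT) (X n)) _ _ _ hE
    (fun n ↦ injective_dualHomTo (hst n)) (fun n φ ↦ by
      have := (hE (n + 1)).mono_f
      have h0 := hom_head_comp_dualHomToMap hN (hst n) (g n ≫ f (n + 1)) (fun φ ψ ↦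
        ObjectProperty.hom_ext _ (R.comp_Δ_eq_zero hT n φ.hom ψ.hom)) φ
      refine (cancel_mono (dualHomToMap (f (n + 1)))).1 (Eq.trans ?_ zero_comp.symm)
      refine (Category.assoc _ _ _).trans (Eq.trans ?_ h0)
      exact congrArg (φ ≫ ·) (dualHomToMap_comp _ _).symm)
  obtain ⟨e'⟩ := nonempty_hom_head_linearEquiv hN (hst n)
  let e₀ : Z 0 ≅ H.truncΔ ⟨a, ha⟩ := Q.isoMk R.iso
  exact ⟨(extLinearEquivOfIso _ n (dualHomToIso e₀)).symm ≪≫ₗ e ≪≫ₗ e'.symm ≪≫ₗ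
    (truncPairingEquiv (H.truncΔ b) (H.truncNabla b) (X n)).symm.dualMap⟩

end Truncation

end HighestWeightCategory
end HighestWeight
end

theorem mainTheorem4 {k : Type v} [Field k] {Λ : Type w} [PartialOrder Λ]
    {C : Type u} [Category.{v} C] [Abelian C] [Linear k C]
    (H : HighestWeight.HighestWeightCategory k Λ C)
    (T : Λ → C) (hT : ∀ a, H.IsIndecomposableTilting a (T a))
    (lam : Λ) (K : CochainComplex H.Tilt ℤ)
    (hK : H.IsMinimalTiltingComplex ((CochainComplex.singleFunctor C 0).obj (H.Δ lam)) K)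
    (i : ℤ) (mu : Λ) (Γ : LowerSet Λ) [Finite Γ] (hlam : lam ∈ Γ) :
    (∀ (n : ℕ) (_ : i = n) (hmu : mu ≤ lam),
      Module.Finite k
        (HighestWeight.ExtGroup (H.dualL hT ⟨mu, Γ.lower hmu hlam⟩) (H.dualNabla hT ⟨lam, hlam⟩) n) ∧
      HighestWeight.HasSummandMultiplicity (K.X i).obj (T mu)
        (Module.finrank k
          (HighestWeight.ExtGroup (H.dualL hT ⟨mu, Γ.lower hmu hlam⟩) (H.dualNabla hT ⟨lam, hlam⟩) n))) ∧
    (¬ (0 ≤ i ∧ mu ≤ lam) → HighestWeight.HasSummandMultiplicity (K.X i).obj (T mu) 0) := by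
  open HighestWeight HighestWeightCategory in
  obtain ⟨hneg, R, hR⟩ := hK.exists_coresolution
  refine ⟨fun n hn hmu ↦ ?_, fun h ↦ ?_⟩
  · subst hn
    obtain ⟨e⟩ := R.nonempty_ext_linearEquiv hT hlam ⟨mu, Γ.lower hmu hlam⟩ n
    have := H.finite_hom (R.X n) (H.nabla mu)
    refine ⟨Module.Finite.equiv e.symm, ?_⟩
    rw [e.finrank_eq, Subspace.dual_finrank_eq, ← hR n]
    exact (hT mu).hasSummandMultiplicity (isGood_of_isTilting (R.tilting n))
      (isCogood_of_isTilting (R.tilting n))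
  · have hmult := (hT mu).hasSummandMultiplicity (isGood_of_isTilting (K.X i).property)
      (isCogood_of_isTilting (K.X i).property)
    -- The multiplicity is the rank of the pairing, which vanishes either because the term is zero
    -- (`i < 0`) or because all its weights are ≤ `lam`, so that it receives no nonzero map from `Δ
    -- mu`.
    suffices pairingKernel k (H.Δ mu) (H.nabla mu) (K.X i).obj = ⊤ by
      rw [this, Module.finrank_zero_of_subsingleton] at hmult
      exact hmult
    refine eq_top_iff.2 fun φ _ g ↦ ?_
    by_cases hi : 0 ≤ i
    · obtain ⟨n, rfl⟩ := Int.eq_ofNat_of_zero_le hi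
      by_contra hg
      have hg0 : g ≠ 0 := fun h0 ↦ hg (by rw [h0, zero_comp])
      exact h ⟨hi, Set.mem_Iic.1 (H.mem_of_hom_Δ (hR n ▸ R.factorsIn hT n) g hg0)⟩
    · exact (isZero_iff_isZero_obj.1 (hneg i (not_le.1 hi))).eq_of_tgt g 0 ▸ zero_comp
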